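/- Let $\mu\neq 0$ and $0<\gamma_{\mathrm m}\le 2$ be real constants. For $x=(\Sigma_{\mathrm{YM}},X_1,X_2,T)\in\mathbb R^4$ put $$\Omega_{\mathrm{YM}}=\Sigma_{\mathrm{YM}}^2+X_1^4+X_2^2,\qquad \Omega_{\mathrm m}=1-\Omega_{\mathrm{YM}},\qquad q=1-X_2^2+\tfrac32\left(\gamma_{\mathrm m}-\tfrac43\right)\Omega_{\mathrm m},$$ and consider the autonomous system $$\begin{aligned} \frac{d\Sigma_{\mathrm{YM}}}{d\bar\tau}&=-\left[(1-q)(1-T)^2\Sigma_{\mathrm{YM}}+2(1-T)TX_1^3+\mu T^2X_2\right],\\ \frac{dX_1}{d\bar\tau}&=-\tfrac12\left[(1-q)(1-T)^2X_1-2(1-T)T\Sigma_{\mathrm{YM}}\right],\\ \frac{dX_2}{d\bar\tau}&=q(1-T)^2X_2+\mu T^2\Sigma_{\mathrm{YM}},\\ \frac{dT}{d\bar\tau}&=\tfrac12(1+q)(1-T)^3T \end{aligned}$$ on the state space $\mathbf S$ of all states with $0\le\Omega_{\mathrm{YM}}\le1$, $0<T<1$ and $(1-T)X_2=\mu TX_1$.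 Let $$\mathrm{D_R}=\{0\le\Sigma_{\mathrm{YM}}^2+X_1^4\le1,\ T=0,\ X_2=0\},\qquad \mathrm{L_R}=\{\Sigma_{\mathrm{YM}}^2+X_1^4=1,\ T=0,\ X_2=0\},$$ and let $\mathrm{FL}_0$ be the origin. A solution has $\alpha$-limit $p$ if it converges to $p$ as $\bar\tau\to-\infty$. **Theorem (past asymptotics).** Below, the "mixed solutions" are those in $\mathbf S$ with $0<\Omega_{\mathrm m}<1$; the convergence claims hold for every mixed solution that is defined on some half-line $(-\infty,a)$. As $\bar\tau\to-\infty$: (i) If $0<\gamma_{\mathrm m}<\frac43$, every mixed solution converges to a point of the circle $\mathrm{L_R}$. Each point $p\in\mathrm{L_R}$ is the $\alpha$-limit of a 2-parameter set of mixed solutions, in the following sense: there is a topological embedding $\Phi:\mathbb R\times\mathbb R\to\mathbb R^4$ such that for each $c\in\mathbb R$ the curve $t\mapsto\Phi(c,t)$, $t\in\mathbb R$, is a mixed solution with $\alpha$-limit $p$, and every mixed solution $v$ on a half-line $(-\infty,a)$ with $\alpha$-limit $p$ has the form $v(t)=\Phi(c,t+s)$ for some $c,s\in\mathbb R$. (One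 parameter labels the orbits, the other is the translation in time.) (ii) If $\gamma_{\mathrm m}=\frac43$, every mixed solution converges to a point of the disk $\mathrm{D_R}$. Each point $p\in\mathrm{D_R}$ is the $\alpha$-limit of a solution in $\mathbf S$ that is defined for all times, and this solution is unique up to translation in time (also among the solutions in $\mathbf S$ that are defined only on a half-line $(-\infty,a)$). Moreover, for $p\in\mathrm{D_R}$, the same existence and uniqueness statement with mixed solutions in place of solutions in $\mathbf S$ holds if and only if $0<\Omega_{\mathrm m}(p)<1$. (iii) If $\gamma_{\mathrm m}>\frac43$, every mixed solution converges to $\mathrm{FL}_0$. -/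

import Mathlib

open Filter Topology

noncomputable section

namespace MassiveYM

/-- A state `x = (Σ_YM, X₁, X₂, T)`. -/
abbrev State : Type := Fin 4 → ℝ

/-- `Ω_YM = Σ_YM² + X₁⁴ + X₂²`. -/
def OmegaYM (x : State) : ℝ := x 0 ^ 2 + x 1 ^ 4 + x 2 ^ 2

/-- `Ω_m = 1 - Ω_YM`. -/
def OmegaM (x : State) : ℝ := 1 - OmegaYM x

/-- The deceleration parameter `q`. -/
def q (γm : ℝ) (x : State) : ℝ :=
  1 - x 2 ^ 2 + 3 / 2 * (γm - 4 / 3) * OmegaM x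

/-- The right-hand side of the evolution equations for `(Σ_YM, X₁, X₂, T)`. -/
def vectorField (μ γm : ℝ) (x : State) : State :=
  ![-((1 - q γm x) * (1 - x 3) ^ 2 * x 0 + 2 * (1 - x 3) * x 3 * x 1 ^ 3 + μ * x 3 ^ 2 * x 2),
    -(1 / 2) * ((1 - q γm x) * (1 - x 3) ^ 2 * x 1 - 2 * (1 - x 3) * x 3 * x 0),
    q γm x * (1 - x 3) ^ 2 * x 2 + μ * x 3 ^ 2 * x 0,
    1 / 2 * (1 + q γm x) * (1 - x 3) ^ 3 * x 3]

/-- The state space: `0 ≤ Ω_YM ≤ 1`, `0 < T < 1`, and the constraint `(1 - T) X₂ = μ T X₁`. -/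
def stateSpace (μ : ℝ) : Set State :=
  {x | 0 ≤ OmegaYM x ∧ OmegaYM x ≤ 1 ∧ 0 < x 3 ∧ x 3 < 1 ∧ (1 - x 3) * x 2 = μ * x 3 * x 1}

/-- The states of the state space with `0 < Ω_m < 1`. -/
def mixedStates (μ : ℝ) : Set State :=
  {x | x ∈ stateSpace μ ∧ 0 < OmegaM x ∧ OmegaM x < 1}

/-- `u` solves the constrained system on the open set `I` of times, with values in `A`
(`A` will be `stateSpace μ` or `mixedStates μ`). -/
def IsSolutionOn (μ γm : ℝ) (A : Set State) (I : Set ℝ) (u : ℝ → State) : Prop :=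
  ∀ t ∈ I, u t ∈ A ∧ HasDerivAt u (vectorField μ γm (u t)) t

/-- The disk `D_R` on the boundary `T = 0`. -/
def diskDR : Set State :=
  {x | 0 ≤ x 0 ^ 2 + x 1 ^ 4 ∧ x 0 ^ 2 + x 1 ^ 4 ≤ 1 ∧ x 3 = 0 ∧ x 2 = 0}

/-- The circle `L_R` on the boundary `T = 0`. -/
def circleLR : Set State :=
  {x | x 0 ^ 2 + x 1 ^ 4 = 1 ∧ x 3 = 0 ∧ x 2 = 0}

/-- The point `FL₀`. -/
def pointFL0 : State := 0

/-- The solutions with `0 < Ω_m < 1` whose `α`-limit is `p` form a 2-parameter set: there is a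
topological embedding `Φ` of the plane such that every curve `t ↦ Φ (c, t)` is such a solution,
and each such solution, on any past half-line, is one of these curves up to a translation in time.
So the set of values of these solutions is a topological plane, with one parameter (`c`) that
labels the orbits and one (`t`) for the position on the orbit. -/
def IsAlphaLimitOfTwoParameterSet (μ γm : ℝ) (p : State) : Prop :=
  ∃ Φ : ℝ × ℝ → State, IsEmbedding Φ ∧
    (∀ c : ℝ, IsSolutionOn μ γm (mixedStates μ) Set.univ (fun t => Φ (c, t)) ∧
      Tendsto (fun t => Φ (c, t)) atBot (𝓝 p)) ∧
    ∀ (a : ℝ) (v : ℝ → State), IsSolutionOn μ γm (mixedStates μ) (Set.Iio a) v →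
      Tendsto v atBot (𝓝 p) → ∃ c s : ℝ, ∀ t < a, v t = Φ (c, t + s)

/-- Up to translation in time, exactly one solution in the set `A` of states has `α`-limit `p`. -/
def IsAlphaLimitOfUniqueSolution (μ γm : ℝ) (A : Set State) (p : State) : Prop :=
  ∃ u : ℝ → State, IsSolutionOn μ γm A Set.univ u ∧ Tendsto u atBot (𝓝 p) ∧
    ∀ (a : ℝ) (v : ℝ → State), IsSolutionOn μ γm A (Set.Iio a) v →
      Tendsto v atBot (𝓝 p) → ∃ s : ℝ, ∀ t < a, v t = u (t + s)

end MassiveYM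

end

/-!
The proof rests on the interpretation of the system as a Friedmann cosmology. With `b = 2 -
3γ_m/2` one has `1 - q = X₂² + b Ω_m`, and the constraint reads `X₂ = μ h X₁` with `h = T / (1 -
T)`.

*Convergence.* Towards the past `T` decreases at least exponentially, so that `T`, and `X₂` with
it, is integrable near `-∞`. Integrability is used in the form `PastBound`: a function is
dominated by the derivative of a function that is bounded below. If `b > 0`, then `-log (Σ_YM² +
X₁²)` is bounded below and its derivative is at least a multiple of `Ω_m` minus a multiple of `T`,
so `Ω_m` is integrable (`pastBound_omegaM`); if `b < 0`, then `-log Ω_m` shows in the same way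
that `Ω_YM` is integrable (`pastBound_omegaYM`). For `b ≥ 0` it follows that `Σ_YM` and `X₁` have
integrable derivatives and converge (`exists_tendsto_of_pastBound`), with `Ω_m → 0` if `b > 0`;
for `b < 0` it follows that `Ω_YM → 0`.

*Solutions with a given limit.* Let `R` be the solution of `R' = (1 - q)(1 - T)² R` with `R → 1`
at `-∞`, and put `r = √R`, `χ = r X₁`, `ϖ = R Σ_YM`, `A = r h`. Here `R` is the expansion rate,
`χ` the Yang-Mills potential, `ϖ` its derivative in conformal time and `A` the scale factor. They
satisfy `dχ/dA = ϖ / R`, `dϖ/dA = -(2 χ³ + μ² A² χ) / R` and the Friedmann equation `R² = ϖ² + χ⁴ + μ² A² χ² + C A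
^ (2b)`, where `C` is a constant of the motion. As `b ≥ 0`, this equation with independent
variable `A` is regular at `A = 0`, although the limit points are degenerate equilibria of the
original system. So for each `C` exactly one solution (`IsProfile`) starts from the values `(X₁,
Σ_YM)` of the limit point at `A = 0`; it exists for all `A` (`exists_isProfile`) and agrees with
every solution of the system that has this limit and this `C` (`IsPhysical.eq_profile`). Time is recovered as
the integral `clock` of `(1 - T)⁻²` over `log A`, which makes the solution unique up to
translation. If `b = 0`, the Friedmann equation at `A = 0` determines `C = Ω_m(p)`. If `b > 0`, it
leaves `C > 0` free, and `C` is the parameter that labels the orbits.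

*The embedding.* The map from `(log C, log A)` to the state is continuous, by continuous
dependence on `C`, and injective, because `C` is the limit of `Ω_m h ^ (-2b)` along the orbit. Its
inverse is continuous because the parameters are bounded in terms of the state
(`planeMap_bounds`): along a profile `log E - 2 μ² A² / √E` decreases, where `E = R² Ω_YM`, and
`A² / √E = h² / √Ω_YM` depends on the state alone.
-/

noncomputable section

namespace MassiveYM

/-! ### Functions that are integrable towards the past -/

theorem monotoneOn_Iio_of_hasDerivAt {a : ℝ} {G G' : ℝ → ℝ}
    (hG : ∀ t < a, HasDerivAt G (G' t) t) (h0 : ∀ t < a, 0 ≤ G' t) :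
    MonotoneOn G (Set.Iio a) := by
  apply monotoneOn_of_deriv_nonneg (convex_Iio a)
  · exact fun t ht => (hG t ht).continuousAt.continuousWithinAt
  · intro t ht
    rw [interior_Iio] at ht
    exact (hG t ht).differentiableAt.differentiableWithinAt
  · intro t ht
    rw [interior_Iio] at ht
    rw [(hG t ht).deriv]
    exact h0 t ht

theorem exists_tendsto_atBot_of_monotoneOn {a m : ℝ} {G : ℝ → ℝ}
    (hG : MonotoneOn G (Set.Iio a)) (hm : ∀ t < a, m ≤ G t) :
    ∃ l, m ≤ l ∧ (∀ t < a, l ≤ G t) ∧ Tendsto G atBot (𝓝 l) := by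
  have hmono : Monotone fun t => G (min t (a - 1)) := fun s t hst =>
    hG (Set.mem_Iio.2 (by grind)) (Set.mem_Iio.2 (by grind)) (min_le_min_right _ hst)
  have hbdd : BddBelow (Set.range fun t => G (min t (a - 1))) := by
    refine ⟨m, ?_⟩
    rintro _ ⟨t, rfl⟩
    exact hm _ (by grind)
  have h1 := tendsto_atBot_ciInf hmono hbdd
  have h2 : Tendsto G atBot (𝓝 (⨅ t, G (min t (a - 1)))) := by
    refine h1.congr' ?_
    filter_upwards [eventually_le_atBot (a - 1)] with t ht
    simp [min_eq_left ht]
  refine ⟨_, le_ciInf fun t => hm _ (by grind), fun t ht => ?_, h2⟩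
  refine le_of_tendsto h2 ?_
  filter_upwards [eventually_le_atBot t] with s hs
  exact hG (Set.mem_Iio.2 (by grind)) ht hs

/-- `g` is bounded above on `(-∞, a)` by the derivative of a function that is bounded below there.
For nonnegative `g` this is integrability towards `-∞`, in a form that involves no integrals. -/
def PastBound (g : ℝ → ℝ) (a : ℝ) : Prop :=
  ∃ (G G' : ℝ → ℝ) (m : ℝ), (∀ t < a, HasDerivAt G (G' t) t) ∧ (∀ t < a, g t ≤ G' t) ∧
    ∀ t < a, m ≤ G t

namespace PastBound

variable {f g : ℝ → ℝ} {a : ℝ}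

theorem mono (hg : PastBound g a) (h : ∀ t < a, f t ≤ g t) : PastBound f a := by
  obtain ⟨G, G', m, h1, h2, h3⟩ := hg
  exact ⟨G, G', m, h1, fun t ht => (h t ht).trans (h2 t ht), h3⟩

theorem add (hf : PastBound f a) (hg : PastBound g a) : PastBound (fun t => f t + g t) a := by
  obtain ⟨F, F', m, h1, h2, h3⟩ := hf
  obtain ⟨G, G', n, k1, k2, k3⟩ := hg
  exact ⟨fun t => F t + G t, fun t => F' t + G' t, m + n, fun t ht => (h1 t ht).add (k1 t ht),
    fun t ht => add_le_add (h2 t ht) (k2 t ht), fun t ht => add_le_add (h3 t ht) (k3 t ht)⟩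

theorem const_mul (hf : PastBound f a) {c : ℝ} (hc : 0 ≤ c) : PastBound (fun t => c * f t) a := by
  obtain ⟨F, F', m, h1, h2, h3⟩ := hf
  exact ⟨fun t => c * F t, fun t => c * F' t, c * m, fun t ht => (h1 t ht).const_mul c,
    fun t ht => mul_le_mul_of_nonneg_left (h2 t ht) hc,
    fun t ht => mul_le_mul_of_nonneg_left (h3 t ht) hc⟩

/-- A function whose derivative is integrable towards `-∞` has a limit there. -/
theorem exists_tendsto (hg : PastBound g a) {f f' : ℝ → ℝ}
    (hf : ∀ t < a, HasDerivAt f (f' t) t) (hle : ∀ t < a, |f' t| ≤ g t) :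
    ∃ l, Tendsto f atBot (𝓝 l) := by
  obtain ⟨G, G', m, h1, h2, h3⟩ := hg
  have hb : ∀ t < a, |f' t| ≤ G' t := fun t ht => (hle t ht).trans (h2 t ht)
  have hG : MonotoneOn G (Set.Iio a) :=
    monotoneOn_Iio_of_hasDerivAt h1 fun t ht => (abs_nonneg _).trans (hb t ht)
  have hp : MonotoneOn (fun t => f t + G t) (Set.Iio a) :=
    monotoneOn_Iio_of_hasDerivAt (fun t ht => (hf t ht).add (h1 t ht))
      fun t ht => by linarith [neg_abs_le (f' t), hb t ht]
  have hn : MonotoneOn (fun t => G t - f t) (Set.Iio a) :=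
    monotoneOn_Iio_of_hasDerivAt (fun t ht => (h1 t ht).sub (hf t ht))
      fun t ht => by linarith [le_abs_self (f' t), hb t ht]
  obtain ⟨l, -, -, hl⟩ := exists_tendsto_atBot_of_monotoneOn hG h3
  have hsub : Set.Iio (a - 1) ⊆ Set.Iio a := Set.Iio_subset_Iio (by linarith)
  obtain ⟨k, -, -, hk⟩ := exists_tendsto_atBot_of_monotoneOn (hp.mono hsub)
    (m := f (a - 1) - G (a - 1) + 2 * m) (fun t ht => by
      have := hn (hsub ht) (Set.mem_Iio.2 (by linarith : a - 1 < a)) (le_of_lt ht)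
      have := h3 t (hsub ht)
      simp only at *
      linarith)
  refine ⟨k - l, (hk.sub hl).congr fun t => ?_⟩
  ring

/-- A function that is integrable towards `-∞` has no positive limit there. -/
theorem limit_nonpos (hg : PastBound g a) {l : ℝ} (hl : Tendsto g atBot (𝓝 l)) : l ≤ 0 := by
  by_contra! hpos
  obtain ⟨G, G', m, h1, h2, h3⟩ := hg
  obtain ⟨t₁, ht₁⟩ := eventually_atBot.1 (hl.eventually_const_le (half_lt_self hpos))
  obtain ⟨b, hba, hbt⟩ : ∃ b, b < a ∧ b ≤ t₁ := ⟨min (a - 1) t₁, by grind, by grind⟩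
  have hmono : MonotoneOn (fun t => G t - l / 2 * t) (Set.Iio b) :=
    monotoneOn_Iio_of_hasDerivAt
      (fun t ht => (h1 t (ht.trans hba)).sub ((hasDerivAt_id t).const_mul (l / 2)))
      fun t ht => by
        have := h2 t (ht.trans hba)
        have := ht₁ t (ht.le.trans hbt)
        linarith
  -- far enough in the past, the linear bound pushes `G` below `m`
  have hlim : Tendsto (fun t => l / 2 * t) atBot atBot :=
    tendsto_id.const_mul_atBot (by positivity)
  obtain ⟨t, ht, ht2⟩ := ((hlim.eventually_lt_atBot
    (m - G (b - 1) + l / 2 * (b - 1))).and (eventually_le_atBot (b - 1))).exists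
  have h5 := hmono (Set.mem_Iio.2 (by linarith)) (Set.mem_Iio.2 (by linarith : b - 1 < b)) ht2
  have h6 := h3 t (by linarith)
  simp only at h5
  linarith

/-- A function that is integrable towards `-∞` together with its derivative tends to `0` there. -/
theorem tendsto_zero (hg : PastBound g a) {g' : ℝ → ℝ} {K : ℝ} (hK : 0 ≤ K)
    (h0 : ∀ t < a, 0 ≤ g t) (hd : ∀ t < a, HasDerivAt g (g' t) t)
    (hle : ∀ t < a, |g' t| ≤ K * g t) : Tendsto g atBot (𝓝 0) := by
  obtain ⟨l, hl⟩ := (hg.const_mul hK).exists_tendsto hd hle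
  have h1 := hg.limit_nonpos hl
  have h2 : 0 ≤ l := ge_of_tendsto hl (by
    filter_upwards [eventually_lt_atBot a] with t ht using h0 t ht)
  rwa [le_antisymm h1 h2] at hl

end PastBound

/-- Uniqueness of solutions issuing from `-∞`: a nonnegative function that tends to `0` at `-∞` and
satisfies the linear differential inequality `D' ≤ K A' D`, with `A` bounded there, vanishes. -/
theorem eq_zero_of_deriv_le_of_tendsto_atBot {D D' A A' : ℝ → ℝ} {a K l : ℝ}
    (hD : ∀ t < a, HasDerivAt D (D' t) t) (hA : ∀ t < a, HasDerivAt A (A' t) t)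
    (h0 : ∀ t < a, 0 ≤ D t) (hle : ∀ t < a, D' t ≤ K * A' t * D t)
    (hDl : Tendsto D atBot (𝓝 0)) (hAl : Tendsto A atBot (𝓝 l)) : ∀ t < a, D t = 0 := by
  have hmono : MonotoneOn (fun t => -(D t * Real.exp (-K * A t))) (Set.Iio a) := by
    refine monotoneOn_Iio_of_hasDerivAt
      (fun t ht => ((hD t ht).mul ((hA t ht).const_mul (-K)).exp).neg) fun t ht => ?_
    have := mul_nonneg (Real.exp_pos (-K * A t)).le (sub_nonneg.2 (hle t ht))
    nlinarith [this]
  have hlim : Tendsto (fun t => -(D t * Real.exp (-K * A t))) atBot (𝓝 0) := by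
    simpa using (hDl.mul ((Real.continuous_exp.tendsto _).comp (hAl.const_mul (-K)))).neg
  intro t ht
  have h1 : -(D t * Real.exp (-K * A t)) ≥ 0 := le_of_tendsto hlim (by
    filter_upwards [eventually_le_atBot t] with s hs
    exact hmono (Set.mem_Iio.2 (by linarith)) ht hs)
  have h2 := Real.exp_pos (-K * A t)
  nlinarith [h0 t ht]

/-! ### Elementary estimates on the state space -/

/-- The exponent `b = 2 - 3γ_m/2`: the fluid contributes the term `C A ^ (2b)` to the Friedmann
equation. It is positive, zero or negative according to the sign of `4/3 - γ_m`. -/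
def fluidExp (γm : ℝ) : ℝ := 2 - 3 / 2 * γm

theorem one_sub_q (γm : ℝ) (x : State) : 1 - q γm x = x 2 ^ 2 + fluidExp γm * OmegaM x := by
  simp only [q, fluidExp]; ring

section StateSpace

variable {μ γm : ℝ} {x : State}

theorem omegaM_nonneg (hx : x ∈ stateSpace μ) : 0 ≤ OmegaM x := by
  have := hx.2.1
  simp only [OmegaM]; linarith

theorem abs_comp_le (hx : x ∈ stateSpace μ) : |x 0| ≤ 1 ∧ |x 1| ≤ 1 ∧ |x 2| ≤ 1 := by
  have h := hx.2.1
  simp only [OmegaYM] at h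
  refine ⟨?_, ?_, ?_⟩
  · rw [← sq_le_one_iff_abs_le_one]; nlinarith [sq_nonneg (x 2), sq_nonneg (x 1 ^ 2)]
  · rw [← sq_le_one_iff_abs_le_one]; nlinarith [sq_nonneg (x 2), sq_nonneg (x 0)]
  · rw [← sq_le_one_iff_abs_le_one]; nlinarith [sq_nonneg (x 0), sq_nonneg (x 1 ^ 2)]

theorem exists_pos_le_one_add_q (μ : ℝ) (hγ : 0 < γm) :
    ∃ k > 0, ∀ x ∈ stateSpace μ, k ≤ 1 + q γm x := by
  refine ⟨min 1 (3 / 2 * γm), by positivity, fun x hx => ?_⟩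
  have h0 := omegaM_nonneg hx
  have h1 : x 2 ^ 2 ≤ 1 - OmegaM x := by
    simp only [OmegaM, OmegaYM]; nlinarith [sq_nonneg (x 0), sq_nonneg (x 1 ^ 2)]
  have hq := one_sub_q γm x
  have hb : fluidExp γm = 2 - 3 / 2 * γm := rfl
  have k1 : min 1 (3 / 2 * γm) ≤ 1 := min_le_left _ _
  have k2 : min 1 (3 / 2 * γm) ≤ 3 / 2 * γm := min_le_right _ _
  have k3 := sq_nonneg (x 2)
  rcases le_total 0 (fluidExp γm) with h | h
  · have : fluidExp γm * OmegaM x ≤ fluidExp γm * (1 - x 2 ^ 2) :=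
      mul_le_mul_of_nonneg_left (by linarith) h
    nlinarith [mul_nonneg (sub_nonneg.2 k2) (by nlinarith : 0 ≤ 1 - x 2 ^ 2),
      mul_nonneg (sub_nonneg.2 k1) k3]
  · nlinarith [mul_nonneg (neg_nonneg.2 h) h0]

/-- The scale-free variable `h = T / (1 - T)` resolves the constraint: `X₂ = μ h X₁`. -/
theorem comp_two_eq (hx : x ∈ stateSpace μ) : x 2 = μ * (x 3 / (1 - x 3)) * x 1 := by
  have h : 1 - x 3 ≠ 0 := by linarith [hx.2.2.2.1]
  field_simp
  linarith [hx.2.2.2.2]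

theorem comp_sq_pos (hx : x ∈ mixedStates μ) : 0 < x 0 ^ 2 + x 1 ^ 2 := by
  by_contra! h
  have h0 : x 0 = 0 := by nlinarith [sq_nonneg (x 0), sq_nonneg (x 1)]
  have h1 : x 1 = 0 := by nlinarith [sq_nonneg (x 0), sq_nonneg (x 1)]
  have h2 : x 2 = 0 := by rw [comp_two_eq hx.1, h1, mul_zero]
  have := hx.2.2
  simp [OmegaM, OmegaYM, h0, h1, h2] at this

/-- The derivative of `Σ_YM² + X₁²` along the flow: the part that does not decay with `T` has a
sign, since `1 - q ≥ b Ω_m`. -/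
theorem mul_comp_sq_le (hb : 0 ≤ fluidExp γm) (hx : x ∈ stateSpace μ) {δ : ℝ} (hδ : 0 < δ)
    (hT : δ ≤ 1 - x 3) :
    (δ ^ 2 * fluidExp γm * OmegaM x - (3 + μ ^ 2 / δ) * x 3) * (x 0 ^ 2 + x 1 ^ 2) ≤
      -(2 * x 0 * vectorField μ γm x 0 + 2 * x 1 * vectorField μ γm x 1) := by
  have hq := one_sub_q γm x
  have hO := omegaM_nonneg hx
  have hX := (abs_comp_le hx).2.1
  have hy := comp_two_eq hx
  have hT0 : 0 < x 3 := hx.2.2.1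
  have hT1 : x 3 < 1 := hx.2.2.2.1
  have hv0 : vectorField μ γm x 0 = -((1 - q γm x) * (1 - x 3) ^ 2 * x 0 +
    2 * (1 - x 3) * x 3 * x 1 ^ 3 + μ * x 3 ^ 2 * x 2) := rfl
  have hv1 : vectorField μ γm x 1 = -(1 / 2) * ((1 - q γm x) * (1 - x 3) ^ 2 * x 1 -
    2 * (1 - x 3) * x 3 * x 0) := rfl
  rw [hv0, hv1, hq]
  generalize OmegaM x = O at *
  generalize x 0 = S at *
  generalize x 1 = X at *
  generalize x 2 = Y at *
  generalize x 3 = T at *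
  generalize fluidExp γm = b at *
  have hT' : 0 < 1 - T := by linarith
  have e : 2 * S * (-((Y ^ 2 + b * O) * (1 - T) ^ 2 * S + 2 * (1 - T) * T * X ^ 3 +
      μ * T ^ 2 * Y)) + 2 * X * (-(1 / 2) * ((Y ^ 2 + b * O) * (1 - T) ^ 2 * X -
      2 * (1 - T) * T * S)) = T * (S * X) *
        (2 * (1 - T) - 4 * (1 - T) * X ^ 2 - 2 * (μ ^ 2 * (T ^ 2 / (1 - T)))) -
        (Y ^ 2 + b * O) * (1 - T) ^ 2 * (2 * S ^ 2 + X ^ 2) := by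
    have : 2 * S * (μ * T ^ 2 * Y) = T * (S * X) * (2 * (μ ^ 2 * (T ^ 2 / (1 - T)))) := by
      rw [hy]; ring
    linear_combination -this
  have hSX : |S * X| ≤ (S ^ 2 + X ^ 2) / 2 := by
    rw [abs_le]; constructor <;> nlinarith [sq_nonneg (S + X), sq_nonneg (S - X)]
  have hX2 : X ^ 2 ≤ 1 := by rwa [sq_le_one_iff_abs_le_one]
  have hdiv : T ^ 2 / (1 - T) ≤ 1 / δ := by
    gcongr
    nlinarith
  have hdiv0 : 0 ≤ μ ^ 2 * (T ^ 2 / (1 - T)) := by positivity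
  have hdiv1 : μ ^ 2 * (T ^ 2 / (1 - T)) ≤ μ ^ 2 / δ := by
    rw [div_eq_mul_one_div (μ ^ 2)]; gcongr
  have hB : |2 * (1 - T) - 4 * (1 - T) * X ^ 2 - 2 * (μ ^ 2 * (T ^ 2 / (1 - T)))| ≤
      2 * (3 + μ ^ 2 / δ) := by
    have := mul_nonneg hT'.le (sq_nonneg X)
    have := mul_le_mul_of_nonneg_left hX2 hT'.le
    rw [abs_le]; constructor <;> linarith
  have hP : T * (S * X) * (2 * (1 - T) - 4 * (1 - T) * X ^ 2 -
      2 * (μ ^ 2 * (T ^ 2 / (1 - T)))) ≤ T * (3 + μ ^ 2 / δ) * (S ^ 2 + X ^ 2) := by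
    refine (le_abs_self _).trans ?_
    rw [abs_mul, abs_mul, abs_of_pos hT0]
    calc T * |S * X| * _ ≤ T * ((S ^ 2 + X ^ 2) / 2) * (2 * (3 + μ ^ 2 / δ)) := by gcongr
      _ = _ := by ring
  have h6 : δ ^ 2 * b * O * (S ^ 2 + X ^ 2) ≤
      (Y ^ 2 + b * O) * (1 - T) ^ 2 * (2 * S ^ 2 + X ^ 2) := by
    have e1 : 0 ≤ b * O := by positivity
    calc _ = (b * O) * δ ^ 2 * (S ^ 2 + X ^ 2) := by ring
      _ ≤ _ := by gcongr <;> linarith [sq_nonneg Y, sq_nonneg S]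
  rw [e, sub_mul]
  linarith

end StateSpace

/-! ### Derivatives along a solution -/

section Solution

variable {μ γm a : ℝ} {u : ℝ → State}

theorem IsSolutionOn.mono {A B : Set State} {I J : Set ℝ} (hu : IsSolutionOn μ γm A I u)
    (hAB : A ⊆ B) (hJI : J ⊆ I) : IsSolutionOn μ γm B J u :=
  fun t ht => ⟨hAB (hu t (hJI ht)).1, (hu t (hJI ht)).2⟩

theorem mixedStates_subset (μ : ℝ) : mixedStates μ ⊆ stateSpace μ := fun _ h => h.1

theorem hasDerivAt_comp {x' : State} {t : ℝ} (h : HasDerivAt u x' t) (i : Fin 4) :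
    HasDerivAt (fun s => u s i) (x' i) t :=
  hasDerivAt_pi.1 h i

theorem hasDerivAt_omegaM {t : ℝ} (h : HasDerivAt u (vectorField μ γm (u t)) t) :
    HasDerivAt (fun s => OmegaM (u s)) (-2 * (1 - u t 3) ^ 2 * OmegaM (u t) *
      (u t 2 ^ 2 - fluidExp γm * OmegaYM (u t))) t := by
  have h0 := hasDerivAt_comp h 0
  have h1 := hasDerivAt_comp h 1
  have h2 := hasDerivAt_comp h 2
  have := (((h0.pow 2).add (h1.pow 4)).add (h2.pow 2)).const_sub 1
  refine this.congr_deriv ?_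
  simp [vectorField, q, OmegaM, OmegaYM, fluidExp]
  ring

theorem hasDerivAt_T {t : ℝ} (h : HasDerivAt u (vectorField μ γm (u t)) t) :
    HasDerivAt (fun s => u s 3) (1 / 2 * (1 + q γm (u t)) * (1 - u t 3) ^ 3 * u t 3) t :=
  hasDerivAt_comp h 3

/-- Towards the past `T` stays away from `1`, grows at least exponentially in time, and dominates
`X₂`. -/
theorem exists_T_bounds (hγ : 0 < γm) (hu : IsSolutionOn μ γm (stateSpace μ) (Set.Iio a) u) :
    ∃ δ > 0, ∃ c > 0, ∀ t < a - 1, δ ≤ 1 - u t 3 ∧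
      c * u t 3 ≤ 1 / 2 * (1 + q γm (u t)) * (1 - u t 3) ^ 3 * u t 3 ∧
      |u t 2| ≤ |μ| / δ * u t 3 := by
  obtain ⟨k, hk, hkq⟩ := exists_pos_le_one_add_q (γm := γm) μ hγ
  have hmono : MonotoneOn (fun t => u t 3) (Set.Iio a) :=
    monotoneOn_Iio_of_hasDerivAt (fun t ht => hasDerivAt_T (hu t ht).2) fun t ht => by
      have h1 := (hu t ht).1
      have h2 := hkq _ h1
      have h3 := h1.2.2.1
      have h4 : 0 < 1 - u t 3 := by linarith [h1.2.2.2.1]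
      have h5 : 0 < 1 + q γm (u t) := by linarith
      positivity
  have ha : a - 1 < a := by linarith
  have hδ : 0 < 1 - u (a - 1) 3 := by linarith [(hu _ ha).1.2.2.2.1]
  refine ⟨1 - u (a - 1) 3, hδ, 1 / 2 * k * (1 - u (a - 1) 3) ^ 3, by positivity, fun t ht => ?_⟩
  have h1 := (hu t (ht.trans ha)).1
  have h2 := h1.2.2.1
  have h3 : 1 - u (a - 1) 3 ≤ 1 - u t 3 := by
    have := hmono (Set.mem_Iio.2 (ht.trans ha)) (Set.mem_Iio.2 ha) ht.le
    simp only at this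
    linarith
  have h4 := hkq _ h1
  refine ⟨h3, ?_, ?_⟩
  · have : (0 : ℝ) < 1 + q γm (u t) := by linarith
    gcongr
  · rw [comp_two_eq h1, abs_mul, abs_mul, abs_of_nonneg (div_nonneg h2.le (hδ.le.trans h3))]
    have h6 := (abs_comp_le h1).2.1
    calc |μ| * (u t 3 / (1 - u t 3)) * |u t 1|
        ≤ |μ| * (u t 3 / (1 - u (a - 1) 3)) * 1 := by gcongr
      _ = |μ| / (1 - u (a - 1) 3) * u t 3 := by ring

theorem pastBound_T (hγ : 0 < γm) (hu : IsSolutionOn μ γm (stateSpace μ) (Set.Iio a) u) :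
    PastBound (fun t => u t 3) (a - 1) := by
  obtain ⟨δ, hδ, c, hc, h⟩ := exists_T_bounds hγ hu
  refine ⟨fun t => c⁻¹ * u t 3, _, 0, fun t ht =>
    (hasDerivAt_T (hu t (Set.mem_Iio.2 (by linarith))).2).const_mul c⁻¹, fun t ht => ?_,
    fun t ht => ?_⟩
  · have := (h t ht).2.1
    rw [inv_mul_eq_div, le_div_iff₀ hc]
    linarith
  · have := (hu t (Set.mem_Iio.2 (by linarith))).1.2.2.1
    positivity

theorem tendsto_T (hγ : 0 < γm) (hu : IsSolutionOn μ γm (stateSpace μ) (Set.Iio a) u) :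
    Tendsto (fun t => u t 3) atBot (𝓝 0) := by
  have hm := pastBound_T hγ hu
  have hmono : MonotoneOn (fun t => u t 3) (Set.Iio (a - 1)) :=
    monotoneOn_Iio_of_hasDerivAt
      (fun t ht => hasDerivAt_T (hu t (Set.mem_Iio.2 (by linarith))).2) fun t ht => by
      obtain ⟨δ, hδ, c, hc, h⟩ := exists_T_bounds hγ hu
      have := (hu t (Set.mem_Iio.2 (by linarith))).1.2.2.1
      exact (by positivity : 0 ≤ c * u t 3).trans (h t ht).2.1
  obtain ⟨l, hl0, -, hl⟩ := exists_tendsto_atBot_of_monotoneOn hmono (m := 0) fun t ht =>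
    (hu t (Set.mem_Iio.2 (by linarith))).1.2.2.1.le
  rwa [le_antisymm (hm.limit_nonpos hl) hl0] at hl

theorem tendsto_comp_two (hγ : 0 < γm) (hu : IsSolutionOn μ γm (stateSpace μ) (Set.Iio a) u) :
    Tendsto (fun t => u t 2) atBot (𝓝 0) := by
  obtain ⟨δ, hδ, c, hc, h⟩ := exists_T_bounds hγ hu
  refine squeeze_zero_norm' (a := fun t => |μ| / δ * u t 3) ?_ ?_
  · filter_upwards [eventually_lt_atBot (a - 1)] with t ht using (h t ht).2.2
  · simpa using (tendsto_T hγ hu).const_mul (|μ| / δ)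

theorem pastBound_comp_two_sq (hγ : 0 < γm)
    (hu : IsSolutionOn μ γm (stateSpace μ) (Set.Iio a) u) :
    PastBound (fun t => u t 2 ^ 2) (a - 1) := by
  obtain ⟨δ, hδ, c, hc, h⟩ := exists_T_bounds hγ hu
  refine ((pastBound_T hγ hu).const_mul (by positivity : 0 ≤ |μ| / δ)).mono fun t ht => ?_
  have h1 := (abs_comp_le (hu t (Set.mem_Iio.2 (by linarith))).1).2.2
  have h2 := (h t ht).2.2
  rw [← sq_abs]
  nlinarith [abs_nonneg (u t 2)]

/-- The fluid stiffer than radiation: `-log Ω_m` is bounded below and its derivative dominates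
`Ω_YM`. -/
theorem pastBound_omegaYM (hγ : 0 < γm) (hb : fluidExp γm < 0)
    (hu : IsSolutionOn μ γm (mixedStates μ) (Set.Iio a) u) :
    PastBound (fun t => OmegaYM (u t)) (a - 1) := by
  obtain ⟨δ, hδ, c, hc, h⟩ := exists_T_bounds hγ (hu.mono (mixedStates_subset μ) subset_rfl)
  have hk : 0 < 2 * δ ^ 2 * -fluidExp γm := by have := neg_pos.2 hb; positivity
  have key : PastBound (fun t => 2 * δ ^ 2 * -fluidExp γm * OmegaYM (u t)) (a - 1) := by
    refine ⟨fun t => -Real.log (OmegaM (u t)), _, 0, fun t ht =>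
      ((hasDerivAt_omegaM (hu t (Set.mem_Iio.2 (by linarith))).2).log
        (hu t (Set.mem_Iio.2 (by linarith))).1.2.1.ne').neg, fun t ht => ?_, fun t ht => ?_⟩
    · have h1 := (hu t (Set.mem_Iio.2 (by linarith))).1
      have h2 := (h t ht).1
      have h3 : 0 ≤ OmegaYM (u t) := h1.1.1
      have h4 : OmegaM (u t) ≠ 0 := h1.2.1.ne'
      have h5 : δ ^ 2 ≤ (1 - u t 3) ^ 2 := by gcongr
      have h6 : 0 ≤ -fluidExp γm * OmegaYM (u t) := mul_nonneg (by linarith) h3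
      have : -(-2 * (1 - u t 3) ^ 2 * OmegaM (u t) *
          (u t 2 ^ 2 - fluidExp γm * OmegaYM (u t)) / OmegaM (u t)) =
          2 * (1 - u t 3) ^ 2 * (u t 2 ^ 2 + -fluidExp γm * OmegaYM (u t)) := by
        field_simp; ring
      rw [this]
      nlinarith [mul_le_mul_of_nonneg_right h5 h6, mul_nonneg (sq_nonneg (1 - u t 3))
        (sq_nonneg (u t 2))]
    · have h1 := (hu t (Set.mem_Iio.2 (by linarith))).1
      have := Real.log_nonpos h1.2.1.le h1.2.2.le
      linarith
  refine (key.const_mul (inv_nonneg.2 hk.le)).mono fun t ht => ?_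
  rw [inv_mul_cancel_left₀ hk.ne']

/-- The fluid softer than radiation: with `W = Σ_YM² + X₁²`, the function `-log W` is bounded below
and its derivative dominates `Ω_m` up to a multiple of `T`. -/
theorem pastBound_omegaM (hγ : 0 < γm) (hb : 0 < fluidExp γm)
    (hu : IsSolutionOn μ γm (mixedStates μ) (Set.Iio a) u) :
    PastBound (fun t => OmegaM (u t)) (a - 1) := by
  have hus := hu.mono (mixedStates_subset μ) subset_rfl
  obtain ⟨δ, hδ, c, hc, h⟩ := exists_T_bounds hγ hus
  have hk : 0 < δ ^ 2 * fluidExp γm := by positivity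
  have key : PastBound (fun t => δ ^ 2 * fluidExp γm * OmegaM (u t) - (3 + μ ^ 2 / δ) * u t 3)
      (a - 1) := by
    have hd : ∀ t < a - 1, HasDerivAt (fun s => u s 0 ^ 2 + u s 1 ^ 2)
        (2 * u t 0 * vectorField μ γm (u t) 0 + 2 * u t 1 * vectorField μ γm (u t) 1) t := by
      intro t ht
      have h1 := (hu t (Set.mem_Iio.2 (by linarith))).2
      refine (((hasDerivAt_comp h1 0).pow 2).add ((hasDerivAt_comp h1 1).pow 2)).congr_deriv ?_
      simp
    refine ⟨fun t => -Real.log (u t 0 ^ 2 + u t 1 ^ 2), _, -Real.log 2, fun t ht =>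
      ((hd t ht).log (comp_sq_pos (hu t (Set.mem_Iio.2 (by linarith))).1).ne').neg,
      fun t ht => ?_, fun t ht => ?_⟩
    · have h1 := (hu t (Set.mem_Iio.2 (by linarith))).1
      rw [neg_div', le_div_iff₀ (comp_sq_pos h1)]
      exact mul_comp_sq_le hb.le h1.1 hδ (h t ht).1
    · have h1 := (hu t (Set.mem_Iio.2 (by linarith))).1
      have hW := comp_sq_pos h1
      obtain ⟨k1, k2, -⟩ := abs_comp_le h1.1
      rw [← sq_le_one_iff_abs_le_one] at k1 k2
      exact neg_le_neg (Real.log_le_log hW (by linarith))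
  refine ((key.add ((pastBound_T hγ hus).const_mul
    (by positivity : 0 ≤ 3 + μ ^ 2 / δ))).const_mul (inv_nonneg.2 hk.le)).mono fun t ht => ?_
  rw [sub_add_cancel, inv_mul_cancel_left₀ hk.ne']

theorem pastBound_one_sub_q_of_eq_zero (hγ : 0 < γm) (hb : fluidExp γm = 0)
    (hu : IsSolutionOn μ γm (stateSpace μ) (Set.Iio a) u) :
    PastBound (fun t => 1 - q γm (u t)) (a - 1) :=
  (pastBound_comp_two_sq hγ hu).mono fun t _ => by rw [one_sub_q, hb]; simp

theorem pastBound_one_sub_q_of_pos (hγ : 0 < γm) (hb : 0 < fluidExp γm)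
    (hu : IsSolutionOn μ γm (mixedStates μ) (Set.Iio a) u) :
    PastBound (fun t => 1 - q γm (u t)) (a - 1) :=
  ((pastBound_comp_two_sq hγ (hu.mono (mixedStates_subset μ) subset_rfl)).add
    ((pastBound_omegaM hγ hb hu).const_mul hb.le)).mono fun t _ => by rw [one_sub_q]

/-! ### Convergence towards the past -/

/-- If the expansion differs integrably from that of a pure radiation universe, then `Σ_YM` and
`X₁`, and with them the state, converge. -/
theorem exists_tendsto_of_pastBound (hγ : 0 < γm) (hb : 0 ≤ fluidExp γm)
    (hu : IsSolutionOn μ γm (stateSpace μ) (Set.Iio a) u)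
    (hq : PastBound (fun t => 1 - q γm (u t)) (a - 1)) :
    ∃ p ∈ diskDR, Tendsto u atBot (𝓝 p) := by
  have hT := pastBound_T hγ hu
  have hbd := hq.add (hT.const_mul (by positivity : 0 ≤ 2 + |μ|))
  have hpt : ∀ t < a - 1, |vectorField μ γm (u t) 0| ≤ 1 - q γm (u t) + (2 + |μ|) * u t 3 ∧
      |vectorField μ γm (u t) 1| ≤ 1 - q γm (u t) + (2 + |μ|) * u t 3 := by
    intro t ht
    have h1 := (hu t (Set.mem_Iio.2 (by linarith))).1
    obtain ⟨k0, k1, k2⟩ := abs_comp_le h1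
    have hT0 : 0 < u t 3 := h1.2.2.1
    have hT1 : u t 3 < 1 := h1.2.2.2.1
    have hq0 : 0 ≤ 1 - q γm (u t) := by
      rw [one_sub_q]; have := omegaM_nonneg h1; positivity
    have hm := abs_nonneg μ
    have hT' : 0 ≤ 1 - u t 3 := by linarith
    have e1 : |(1 - q γm (u t)) * (1 - u t 3) ^ 2| ≤ 1 - q γm (u t) := by
      rw [abs_of_nonneg (by positivity)]
      exact mul_le_of_le_one_right hq0 (pow_le_one₀ hT' (by linarith))
    have e2 : |2 * (1 - u t 3) * u t 3| ≤ 2 * u t 3 := by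
      rw [abs_of_nonneg (by positivity)]; nlinarith
    have e3 : |μ * u t 3 ^ 2| ≤ |μ| * u t 3 := by
      rw [abs_mul, abs_of_nonneg (sq_nonneg (u t 3))]
      gcongr
      nlinarith
    have hmul : ∀ {y z w : ℝ}, |y| ≤ w → |z| ≤ 1 → |y * z| ≤ w := fun {y z w} hy hz => by
      rw [abs_mul]
      exact (mul_le_of_le_one_right (abs_nonneg y) hz).trans hy
    have k3 : |u t 1 ^ 3| ≤ 1 := by rw [abs_pow]; exact pow_le_one₀ (abs_nonneg _) k1
    have a1 := abs_le.1 (hmul e1 k0)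
    have a2 := abs_le.1 (hmul e2 k3)
    have a3 := abs_le.1 (hmul e3 k2)
    have a4 := abs_le.1 (hmul e1 k1)
    have a5 := abs_le.1 (hmul e2 k0)
    have := mul_nonneg hm hT0.le
    constructor
    · simp only [vectorField, Matrix.cons_val_zero]
      rw [abs_le]; constructor <;> linarith
    · simp only [vectorField, Matrix.cons_val_one, Matrix.cons_val_zero]
      rw [abs_le]; constructor <;> linarith
  have hd : ∀ i, ∀ t < a - 1, HasDerivAt (fun s => u s i) (vectorField μ γm (u t) i) t :=
    fun i t ht => hasDerivAt_comp (hu t (Set.mem_Iio.2 (by linarith))).2 i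
  obtain ⟨l0, h0⟩ := hbd.exists_tendsto (hd 0) fun t ht => (hpt t ht).1
  obtain ⟨l1, h1⟩ := hbd.exists_tendsto (hd 1) fun t ht => (hpt t ht).2
  refine ⟨![l0, l1, 0, 0], ⟨by simp; positivity, ?_, by simp, by simp⟩, tendsto_pi_nhds.2 ?_⟩
  · refine le_of_tendsto ((h0.pow 2).add (h1.pow 4)) ?_
    filter_upwards [eventually_lt_atBot a] with t ht
    have := (hu t ht).1.2.1
    simp only [OmegaYM] at this
    nlinarith [sq_nonneg (u t 2)]
  · intro i
    fin_cases i
    exacts [h0, h1, tendsto_comp_two hγ hu, tendsto_T hγ hu]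

theorem continuous_omegaM : Continuous OmegaM := by
  unfold OmegaM OmegaYM; fun_prop

theorem exists_tendsto_circleLR (hγ : 0 < γm) (hb : 0 < fluidExp γm)
    (hu : IsSolutionOn μ γm (mixedStates μ) (Set.Iio a) u) :
    ∃ p ∈ circleLR, Tendsto u atBot (𝓝 p) := by
  obtain ⟨p, hp, hup⟩ := exists_tendsto_of_pastBound hγ hb.le
    (hu.mono (mixedStates_subset μ) subset_rfl) (pastBound_one_sub_q_of_pos hγ hb hu)
  have h1 : OmegaM p ≤ 0 :=
    (pastBound_omegaM hγ hb hu).limit_nonpos ((continuous_omegaM.tendsto p).comp hup)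
  refine ⟨p, ⟨le_antisymm hp.2.1 ?_, hp.2.2.1, hp.2.2.2⟩, hup⟩
  simp only [OmegaM, OmegaYM, hp.2.2.2] at h1
  linarith

theorem tendsto_pointFL0 (hγ : 0 < γm) (hb : fluidExp γm < 0)
    (hu : IsSolutionOn μ γm (mixedStates μ) (Set.Iio a) u) : Tendsto u atBot (𝓝 pointFL0) := by
  have hus := hu.mono (mixedStates_subset μ) subset_rfl
  have hY : Tendsto (fun t => OmegaYM (u t)) atBot (𝓝 0) := by
    refine (pastBound_omegaYM hγ hb hu).tendsto_zero (K := 2 * (1 + |fluidExp γm|))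
      (by positivity) (fun t ht => (hu t (Set.mem_Iio.2 (by linarith))).1.1.1)
      (fun t ht => ((hasDerivAt_omegaM (hu t (Set.mem_Iio.2 (by linarith))).2).const_sub
        1).congr_of_eventuallyEq (Eventually.of_forall fun s => ?_)) fun t ht => ?_
    · simp [OmegaM]
    · have h1 := (hu t (Set.mem_Iio.2 (by linarith))).1
      have h2 : u t 2 ^ 2 ≤ OmegaYM (u t) := by
        simp only [OmegaYM]; nlinarith [sq_nonneg (u t 0), sq_nonneg (u t 1 ^ 2)]
      have hT0 : 0 < u t 3 := h1.1.2.2.1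
      have hT1 : u t 3 < 1 := h1.1.2.2.2.1
      have hm := h1.2
      have e1 : |2 * (1 - u t 3) ^ 2 * OmegaM (u t)| ≤ 2 := by
        rw [abs_of_nonneg (by have := hm.1; positivity)]
        have : (1 - u t 3) ^ 2 * OmegaM (u t) ≤ 1 :=
          mul_le_one₀ (pow_le_one₀ (by linarith) (by linarith)) hm.1.le hm.2.le
        linarith
      have e2 : |u t 2 ^ 2 - fluidExp γm * OmegaYM (u t)| ≤
          (1 + |fluidExp γm|) * OmegaYM (u t) := by
        have := neg_abs_le (fluidExp γm)
        have := h1.1.1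
        rw [abs_of_neg hb, abs_of_nonneg (by nlinarith [sq_nonneg (u t 2)])]
        linarith
      rw [show -(-2 * (1 - u t 3) ^ 2 * OmegaM (u t) *
          (u t 2 ^ 2 - fluidExp γm * OmegaYM (u t))) = (2 * (1 - u t 3) ^ 2 * OmegaM (u t)) *
          (u t 2 ^ 2 - fluidExp γm * OmegaYM (u t)) by ring, abs_mul]
      exact (mul_le_mul e1 e2 (abs_nonneg _) (by norm_num)).trans_eq (by ring)
  have h0 : Tendsto (fun t => u t 0) atBot (𝓝 0) := by
    refine squeeze_zero_norm' (a := fun t => √(OmegaYM (u t))) ?_ ?_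
    · filter_upwards with t
      refine Real.abs_le_sqrt ?_
      simp only [OmegaYM]; nlinarith [sq_nonneg (u t 2), sq_nonneg (u t 1 ^ 2)]
    · simpa using hY.sqrt
  have h1 : Tendsto (fun t => u t 1) atBot (𝓝 0) := by
    refine squeeze_zero_norm' (a := fun t => √√(OmegaYM (u t))) ?_ ?_
    · filter_upwards with t
      refine Real.abs_le_sqrt (Real.le_sqrt_of_sq_le ?_)
      simp only [OmegaYM]; nlinarith [sq_nonneg (u t 2), sq_nonneg (u t 0)]
    · simpa using hY.sqrt.sqrt
  refine tendsto_pi_nhds.2 fun i => ?_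
  fin_cases i
  exacts [h0, h1, tendsto_comp_two hγ hus, tendsto_T hγ hus]

end Solution

/-! ### Global solutions of ordinary differential equations -/

section ODE

variable {E : Type*} [NormedAddCommGroup E]

/-- The time-dependent vector field `f` is Lipschitz in the state, uniformly on bounded sets of
times and states. -/
def LipschitzOnBounded (f : ℝ → E → E) : Prop :=
  ∀ M B : ℝ, ∃ K, ∀ A, |A| ≤ B → LipschitzOnWith K (f A) (Metric.closedBall 0 M)

variable [NormedSpace ℝ E] {f : ℝ → E → E}

theorem LipschitzOnBounded.eqOn (hf : LipschitzOnBounded f) {B : ℝ} (hB : 0 < B) {v w : ℝ → E}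
    (hv : ∀ A ∈ Set.Icc (-B) B, HasDerivWithinAt v (f A (v A)) (Set.Icc (-B) B) A)
    (hw : ∀ A ∈ Set.Icc (-B) B, HasDerivWithinAt w (f A (w A)) (Set.Icc (-B) B) A)
    (h0 : v 0 = w 0) : Set.EqOn v w (Set.Icc (-B) B) := by
  have hvc : ContinuousOn v (Set.Icc (-B) B) := fun A hA => (hv A hA).continuousWithinAt
  have hwc : ContinuousOn w (Set.Icc (-B) B) := fun A hA => (hw A hA).continuousWithinAt
  obtain ⟨M, hM⟩ := (isCompact_Icc.image_of_continuousOn hvc).isBounded.exists_norm_le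
  obtain ⟨N, hN⟩ := (isCompact_Icc.image_of_continuousOn hwc).isBounded.exists_norm_le
  obtain ⟨K, hK⟩ := hf (max M N) B
  refine ODE_solution_unique_of_mem_Icc (s := fun _ => Metric.closedBall 0 (max M N))
    (fun A hA => hK A (abs_le.2 ⟨hA.1.le, hA.2.le⟩)) (t₀ := 0) ⟨by linarith, hB⟩ hvc
    (fun A hA => (hv A ⟨hA.1.le, hA.2.le⟩).hasDerivAt (Icc_mem_nhds hA.1 hA.2))
    (fun A hA => ?_) hwc
    (fun A hA => (hw A ⟨hA.1.le, hA.2.le⟩).hasDerivAt (Icc_mem_nhds hA.1 hA.2))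
    (fun A hA => ?_) h0
  · rw [mem_closedBall_zero_iff]
    exact (hM _ ⟨A, ⟨hA.1.le, hA.2.le⟩, rfl⟩).trans (le_max_left _ _)
  · rw [mem_closedBall_zero_iff]
    exact (hN _ ⟨A, ⟨hA.1.le, hA.2.le⟩, rfl⟩).trans (le_max_right _ _)

/-- Solutions on all bounded intervals glue to a global solution. -/
theorem LipschitzOnBounded.exists_global (hf : LipschitzOnBounded f) {w₀ : E}
    (hex : ∀ B > 0, ∃ v : ℝ → E, v 0 = w₀ ∧
      ∀ A ∈ Set.Icc (-B) B, HasDerivWithinAt v (f A (v A)) (Set.Icc (-B) B) A) :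
    ∃ v : ℝ → E, v 0 = w₀ ∧ ∀ A, HasDerivAt v (f A (v A)) A := by
  choose! V hV0 hV using hex
  have key : ∀ B > 0, ∀ A ∈ Set.Icc (-B) B, V (|A| + 1) A = V B A := by
    intro B hB A hA
    have hA' : |A| ≤ B := abs_le.2 hA
    have h1 : 0 < |A| + 1 := by positivity
    rcases le_total B (|A| + 1) with h | h
    · refine hf.eqOn hB (fun s hs => ?_) (hV B hB) ((hV0 _ h1).trans (hV0 _ hB).symm) hA
      exact (hV _ h1 s ⟨by linarith [hs.1], by linarith [hs.2]⟩).mono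
        (Set.Icc_subset_Icc (by linarith) h)
    · refine hf.eqOn h1 (hV _ h1) (fun s hs => ?_) ((hV0 _ h1).trans (hV0 _ hB).symm)
        (abs_le.1 (by linarith))
      exact (hV _ hB s ⟨by linarith [hs.1], by linarith [hs.2]⟩).mono
        (Set.Icc_subset_Icc (by linarith) h)
  refine ⟨fun A => V (|A| + 1) A, by simpa using hV0 1 one_pos, fun A => ?_⟩
  have hB : 0 < |A| + 1 := by positivity
  have hA : -(|A| + 1) < A ∧ A < |A| + 1 := abs_lt.1 (by linarith)
  have h1 := (hV _ hB A ⟨hA.1.le, hA.2.le⟩).hasDerivAt (Icc_mem_nhds hA.1 hA.2)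
  refine h1.congr_of_eventuallyEq ?_
  filter_upwards [Icc_mem_nhds hA.1 hA.2] with s hs using key _ hB s hs

end ODE

/-! ### The Yang-Mills field as a function of the scale factor -/

/-- The square of the expansion rate, as a function of the scale factor `A` and of
`w = (χ, ϖ, C)`, where `χ` is the potential, `ϖ` its derivative with respect to conformal time and
`C` the amount of fluid. The absolute values matter only for `A < 0` or `C < 0`; with them the
function is defined and continuous everywhere. -/
def rateSq (μ b A : ℝ) (w : ℝ × ℝ × ℝ) : ℝ :=
  w.2.1 ^ 2 + w.1 ^ 4 + μ ^ 2 * A ^ 2 * w.1 ^ 2 + |w.2.2 * |A| ^ (2 * b)|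

/-- The expansion rate, cut off from below at `1`. The solutions of interest start at `1` and have
growing rate, so that the cut-off is never active on them. -/
def rate (μ b A : ℝ) (w : ℝ × ℝ × ℝ) : ℝ := √(max 1 (rateSq μ b A w))

/-- The Yang-Mills equation `χ'' = -2 χ³ - μ² A² χ` with the scale factor as independent
variable. -/
def ymField (μ b A : ℝ) (w : ℝ × ℝ × ℝ) : ℝ × ℝ × ℝ :=
  (w.2.1 * (rate μ b A w)⁻¹, -(2 * w.1 ^ 3 + μ ^ 2 * A ^ 2 * w.1) * (rate μ b A w)⁻¹, 0)

variable {μ b : ℝ}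

theorem one_le_rate (μ b A : ℝ) (w : ℝ × ℝ × ℝ) : 1 ≤ rate μ b A w :=
  Real.one_le_sqrt.2 (le_max_left _ _)

theorem rate_pos (μ b A : ℝ) (w : ℝ × ℝ × ℝ) : 0 < rate μ b A w :=
  one_pos.trans_le (one_le_rate μ b A w)

theorem rate_sq {A : ℝ} {w : ℝ × ℝ × ℝ} (h : 1 ≤ rateSq μ b A w) :
    rate μ b A w ^ 2 = rateSq μ b A w := by
  rw [rate, max_eq_right h, Real.sq_sqrt (by linarith)]

theorem continuous_rate (hb : 0 ≤ b) :
    Continuous fun z : ℝ × ℝ × ℝ × ℝ => rate μ b z.1 z.2 := by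
  have h : Continuous fun z : ℝ × ℝ × ℝ × ℝ => |z.1| ^ (2 * b) :=
    (Real.continuous_rpow_const (by positivity)).comp (by fun_prop)
  unfold rate rateSq
  fun_prop

theorem continuous_ymField (hb : 0 ≤ b) :
    Continuous fun z : ℝ × ℝ × ℝ × ℝ => ymField μ b z.1 z.2 := by
  have h := continuous_rate (μ := μ) hb
  have h' : Continuous fun z : ℝ × ℝ × ℝ × ℝ => (rate μ b z.1 z.2)⁻¹ :=
    h.inv₀ fun z => (rate_pos _ _ _ _).ne'
  unfold ymField
  fun_prop

theorem lipschitzWith_inv_sqrt_max : LipschitzWith 1 fun z : ℝ => (√(max 1 z))⁻¹ := by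
  have hkey : ∀ y z : ℝ, 1 ≤ y → y ≤ z → (√y)⁻¹ - (√z)⁻¹ ≤ z - y := by
    intro y z hy hyz
    have h1 : 1 ≤ √y := Real.one_le_sqrt.2 hy
    have h2 : √y ≤ √z := Real.sqrt_le_sqrt hyz
    have h3 := Real.sq_sqrt (by linarith : 0 ≤ y)
    have h4 := Real.sq_sqrt (by linarith : 0 ≤ z)
    have h5 : 0 < √y * √z := by nlinarith
    rw [inv_sub_inv (by positivity) (by nlinarith), div_le_iff₀ h5]
    nlinarith [mul_nonneg (sub_nonneg.2 h2) (sub_nonneg.2 h1),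
      mul_nonneg (sub_nonneg.2 h2) (sub_nonneg.2 (h1.trans h2)), mul_nonneg
        (sub_nonneg.2 hyz) (by nlinarith : 0 ≤ √y * √z - 1)]
  refine LipschitzWith.of_le_add_mul 1 fun y z => ?_
  rw [NNReal.coe_one, one_mul, Real.dist_eq]
  have h1 : |max 1 y - max 1 z| ≤ |y - z| := by
    simpa [max_comm] using abs_max_sub_max_le_abs y z 1
  rcases le_total (max 1 y) (max 1 z) with h | h
  · have := hkey _ _ (le_max_left 1 y) h
    rw [abs_sub_comm, abs_of_nonneg (sub_nonneg.2 h)] at h1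
    linarith
  · have : (√(max 1 y))⁻¹ ≤ (√(max 1 z))⁻¹ := by
      gcongr
    linarith [abs_nonneg (y - z)]

theorem lipschitzOnBounded_ymField (hb : 0 ≤ b) : LipschitzOnBounded (ymField μ b) := by
  intro M B
  -- `A` and `|A| ^ (2b)` enter as independent parameters, on which the field depends smoothly
  let Q : (ℝ × ℝ) × (ℝ × ℝ × ℝ) → ℝ := fun z =>
    z.2.2.1 ^ 2 + z.2.1 ^ 4 + μ ^ 2 * z.1.1 ^ 2 * z.2.1 ^ 2 + |z.2.2.2 * z.1.2|
  have hQ : LocallyLipschitz Q := by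
    have h1 : ContDiff ℝ 1 fun z : (ℝ × ℝ) × (ℝ × ℝ × ℝ) =>
        (z.2.2.1 ^ 2 + z.2.1 ^ 4 + μ ^ 2 * z.1.1 ^ 2 * z.2.1 ^ 2, z.2.2.2 * z.1.2) := by fun_prop
    have h2 : LocallyLipschitz fun z : ℝ × ℝ => (z.1, |z.2|) :=
      LipschitzWith.prod_fst.locallyLipschitz.prodMk
        ((lipschitzWith_one_norm (E := ℝ)).comp LipschitzWith.prod_snd).locallyLipschitz
    have h3 : ContDiff ℝ 1 fun z : ℝ × ℝ => z.1 + z.2 := by fun_prop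
    exact h3.locallyLipschitz.comp (h2.comp h1.locallyLipschitz)
  let F : (ℝ × ℝ) × (ℝ × ℝ × ℝ) → ℝ × ℝ × ℝ := fun z =>
    (z.2.2.1 * (√(max 1 (Q z)))⁻¹,
      -(2 * z.2.1 ^ 3 + μ ^ 2 * z.1.1 ^ 2 * z.2.1) * (√(max 1 (Q z)))⁻¹, 0)
  have hF : LocallyLipschitz F := by
    have h1 : ContDiff ℝ 1 fun z : ((ℝ × ℝ) × (ℝ × ℝ × ℝ)) × ℝ => (z.1.2.2.1 * z.2,
        -(2 * z.1.2.1 ^ 3 + μ ^ 2 * z.1.1.1 ^ 2 * z.1.2.1) * z.2, (0 : ℝ)) := by fun_prop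
    exact h1.locallyLipschitz.comp (LocallyLipschitz.id.prodMk
      (lipschitzWith_inv_sqrt_max.locallyLipschitz.comp hQ))
  have hc : Continuous fun A : ℝ => (A, |A| ^ (2 * b)) :=
    continuous_id.prodMk ((Real.continuous_rpow_const (by positivity)).comp continuous_abs)
  have hK : IsCompact (((fun A : ℝ => (A, |A| ^ (2 * b))) '' Set.Icc (-B) B) ×ˢ
      Metric.closedBall (0 : ℝ × ℝ × ℝ) M) :=
    (isCompact_Icc.image hc).prod (isCompact_closedBall _ _)
  obtain ⟨K, hK⟩ := LocallyLipschitzOn.exists_lipschitzOnWith_of_compact hK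
    hF.locallyLipschitzOn
  refine ⟨K, fun A hA w hw z hz => ?_⟩
  have := hK (x := ((A, |A| ^ (2 * b)), w)) ⟨⟨A, abs_le.1 hA, rfl⟩, hw⟩
    (y := ((A, |A| ^ (2 * b)), z)) ⟨⟨A, abs_le.1 hA, rfl⟩, hz⟩
  simpa [Prod.edist_eq] using! this

theorem abs_mul_inv_rate_le (A : ℝ) (w : ℝ × ℝ × ℝ) : |w.2.1 * (rate μ b A w)⁻¹| ≤ 1 := by
  have h : |w.2.1| ≤ rate μ b A w := by
    refine Real.abs_le_sqrt (le_max_of_le_right ?_)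
    unfold rateSq
    have : 0 ≤ w.1 ^ 4 + μ ^ 2 * A ^ 2 * w.1 ^ 2 + |w.2.2 * |A| ^ (2 * b)| := by positivity
    linarith
  rw [abs_mul, abs_inv, abs_of_pos (rate_pos _ _ _ _)]
  exact mul_inv_le_one_of_le₀ h (rate_pos _ _ _ _).le

theorem abs_ymField_snd_le {A m B : ℝ} {w : ℝ × ℝ × ℝ} (hA : |A| ≤ B) (hw : |w.1| ≤ m) :
    |-(2 * w.1 ^ 3 + μ ^ 2 * A ^ 2 * w.1) * (rate μ b A w)⁻¹| ≤ 2 * m ^ 3 + μ ^ 2 * B ^ 2 * m := by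
  rw [abs_mul, abs_neg, abs_inv, abs_of_pos (rate_pos _ _ _ _)]
  have h1 : |2 * w.1 ^ 3 + μ ^ 2 * A ^ 2 * w.1| ≤ 2 * m ^ 3 + μ ^ 2 * B ^ 2 * m := by
    refine (abs_add_le _ _).trans ?_
    rw [abs_mul, abs_mul, abs_mul, abs_pow, abs_pow, abs_pow, sq_abs μ, abs_two]
    gcongr
  exact (mul_le_of_le_one_right (abs_nonneg _)
    (inv_le_one_of_one_le₀ (one_le_rate _ _ _ _))).trans h1

/-- Rescaling of the momentum component. -/
def scaleMom (c : ℝ) : (ℝ × ℝ × ℝ) →L[ℝ] (ℝ × ℝ × ℝ) :=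
  (ContinuousLinearMap.id ℝ ℝ).prodMap
    ((c • ContinuousLinearMap.id ℝ ℝ).prodMap (ContinuousLinearMap.id ℝ ℝ))

theorem scaleMom_apply (c : ℝ) (w : ℝ × ℝ × ℝ) : scaleMom c w = (w.1, c * w.2.1, w.2.2) := by
  simp [scaleMom, Prod.map]

/-- The first component of the field is bounded by `1` and the second one by a bound on `χ`. In
units in which the momentum is small enough, the field is therefore bounded by `1` on the ball of
radius `B`, and the Picard-Lindelöf theorem applies to the whole interval `[-B, B]`. -/
theorem exists_solution_Icc (hb : 0 ≤ b) (w₀ : ℝ × ℝ × ℝ) {B : ℝ} (hB : 0 < B) :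
    ∃ v : ℝ → ℝ × ℝ × ℝ, v 0 = w₀ ∧ ∀ A ∈ Set.Icc (-B) B,
      HasDerivWithinAt v (ymField μ b A (v A)) (Set.Icc (-B) B) A := by
  set m := |w₀.1| + B with hm
  set c := 1 + (2 * m ^ 3 + μ ^ 2 * B ^ 2 * m) with hc
  have hm0 : 0 < m := by positivity
  have hc1 : 0 < c := by positivity
  have hcc : ∀ w, scaleMom c (scaleMom c⁻¹ w) = w := fun w => by
    simp [scaleMom_apply, hc1.ne']
  set g : ℝ → ℝ × ℝ × ℝ → ℝ × ℝ × ℝ := fun A z => scaleMom c⁻¹ (ymField μ b A (scaleMom c z))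
  set z₀ := scaleMom c⁻¹ w₀
  lift B to NNReal using hB.le
  obtain ⟨K, hK⟩ := lipschitzOnBounded_ymField (μ := μ) hb
    (‖scaleMom c‖ * (‖z₀‖ + B)) B
  have hmaps : Set.MapsTo (scaleMom c) (Metric.closedBall z₀ B)
      (Metric.closedBall 0 (‖scaleMom c‖ * (‖z₀‖ + B))) := by
    intro z hz
    rw [mem_closedBall_zero_iff]
    refine (ContinuousLinearMap.le_opNorm _ _).trans ?_
    gcongr
    have := norm_sub_norm_le z z₀
    rw [mem_closedBall_iff_norm] at hz
    linarith
  have hpl : IsPicardLindelof g (tmin := -B) (tmax := B)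
      ⟨0, by simp, by simp⟩ z₀ B 0 1 (‖scaleMom c⁻¹‖₊ * (K * ‖scaleMom c‖₊)) := by
    refine ⟨fun A hA => ?_, fun z _ => ?_, fun A hA z hz => ?_, by simp⟩
    · exact (scaleMom c⁻¹).lipschitz.comp_lipschitzOnWith ((hK A (abs_le.2 hA)).comp
        (scaleMom c).lipschitz.lipschitzOnWith hmaps)
    · exact ((scaleMom c⁻¹).continuous.comp ((continuous_ymField hb).comp
        (continuous_id.prodMk continuous_const))).continuousOn
    · have h1 := abs_mul_inv_rate_le (μ := μ) (b := b) A (scaleMom c z)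
      have hz1 : |(scaleMom c z).1| ≤ m := by
        rw [mem_closedBall_iff_norm] at hz
        have h2 := (norm_fst_le (z - z₀)).trans hz
        have h3 : (z - z₀).1 = z.1 - w₀.1 := by simp [z₀, scaleMom_apply]
        rw [h3, Real.norm_eq_abs] at h2
        rw [scaleMom_apply]
        have := abs_sub_abs_le_abs_sub z.1 w₀.1
        simp only
        linarith
      have h2 := abs_ymField_snd_le (μ := μ) (b := b) (abs_le.2 hA) hz1
      simp only [g]
      rw [scaleMom_apply, Prod.norm_def, Prod.norm_def]
      simp only [ymField, Real.norm_eq_abs, NNReal.coe_one, sup_le_iff, abs_zero, zero_le_one,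
        and_true]
      refine ⟨h1, ?_⟩
      rw [abs_mul, abs_inv, abs_of_pos hc1, inv_mul_le_one₀ hc1]
      linarith
  obtain ⟨α, hα0, hα⟩ := hpl.exists_eq_forall_mem_Icc_hasDerivWithinAt₀
  refine ⟨fun A => scaleMom c (α A), ?_, fun A hA => ?_⟩
  · exact (congrArg (scaleMom c) hα0).trans (hcc w₀)
  · have := (scaleMom c).hasFDerivAt.comp_hasDerivWithinAt A (hα A hA)
    simp only [g, hcc] at this
    exact this

/-- `v` is the solution of the Yang-Mills equation, as a function of the scale factor, with value
`w₀ = (χ, ϖ, C)` at the initial singularity `A = 0`. -/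
def IsProfile (μ b : ℝ) (w₀ : ℝ × ℝ × ℝ) (v : ℝ → ℝ × ℝ × ℝ) : Prop :=
  v 0 = w₀ ∧ ∀ A, HasDerivAt v (ymField μ b A (v A)) A

theorem exists_isProfile (hb : 0 ≤ b) (w₀ : ℝ × ℝ × ℝ) : ∃ v, IsProfile μ b w₀ v :=
  (lipschitzOnBounded_ymField hb).exists_global fun _ hB => exists_solution_Icc hb w₀ hB

namespace IsProfile

variable {w₀ : ℝ × ℝ × ℝ} {v : ℝ → ℝ × ℝ × ℝ}

theorem hasDerivAt_fst (hv : IsProfile μ b w₀ v) (A : ℝ) :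
    HasDerivAt (fun s => (v s).1) ((v A).2.1 * (rate μ b A (v A))⁻¹) A :=
  (ContinuousLinearMap.fst ℝ ℝ (ℝ × ℝ)).hasFDerivAt.comp_hasDerivAt A (hv.2 A)

theorem hasDerivAt_snd (hv : IsProfile μ b w₀ v) (A : ℝ) : HasDerivAt (fun s => (v s).2.1)
    (-(2 * (v A).1 ^ 3 + μ ^ 2 * A ^ 2 * (v A).1) * (rate μ b A (v A))⁻¹) A :=
  ((ContinuousLinearMap.fst ℝ ℝ ℝ).comp
    (ContinuousLinearMap.snd ℝ ℝ (ℝ × ℝ))).hasFDerivAt.comp_hasDerivAt A (hv.2 A)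

theorem snd_snd (hv : IsProfile μ b w₀ v) (A : ℝ) : (v A).2.2 = w₀.2.2 := by
  have h : ∀ A, HasDerivAt (fun s => (v s).2.2) 0 A := fun A =>
    ((ContinuousLinearMap.snd ℝ ℝ ℝ).comp
      (ContinuousLinearMap.snd ℝ ℝ (ℝ × ℝ))).hasFDerivAt.comp_hasDerivAt A (hv.2 A)
  have := is_const_of_deriv_eq_zero (fun A => (h A).differentiableAt) (fun A => (h A).deriv) A 0
  rw [this, hv.1]

theorem continuous (hv : IsProfile μ b w₀ v) : Continuous v :=
  continuous_iff_continuousAt.2 fun A => (hv.2 A).continuousAt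

theorem continuous_rate (hb : 0 ≤ b) (hv : IsProfile μ b w₀ v) :
    Continuous fun A => rate μ b A (v A) :=
  (MassiveYM.continuous_rate hb).comp (continuous_id.prodMk hv.continuous)

theorem abs_fst_le (hv : IsProfile μ b w₀ v) (A : ℝ) : |(v A).1| ≤ |w₀.1| + |A| := by
  have := convex_univ.norm_image_sub_le_of_norm_hasDerivWithin_le
    (fun s _ => (hv.hasDerivAt_fst s).hasDerivWithinAt) (C := 1)
    (fun s _ => abs_mul_inv_rate_le s (v s)) (Set.mem_univ 0) (Set.mem_univ A)
  rw [hv.1, one_mul, sub_zero, Real.norm_eq_abs, Real.norm_eq_abs] at this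
  linarith [abs_sub_abs_le_abs_sub (v A).1 w₀.1]

theorem abs_snd_le (hv : IsProfile μ b w₀ v) {A B : ℝ} (hA : |A| ≤ B) :
    |(v A).2.1| ≤ |w₀.2.1| + (2 * (|w₀.1| + B) ^ 3 + μ ^ 2 * B ^ 2 * (|w₀.1| + B)) * B := by
  have hB : 0 ≤ B := (abs_nonneg A).trans hA
  have := (convex_Icc (-B) B).norm_image_sub_le_of_norm_hasDerivWithin_le
    (fun s _ => (hv.hasDerivAt_snd s).hasDerivWithinAt)
    (C := 2 * (|w₀.1| + B) ^ 3 + μ ^ 2 * B ^ 2 * (|w₀.1| + B))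
    (fun s hs => abs_ymField_snd_le (abs_le.2 hs) (by
      linarith [hv.abs_fst_le s, abs_le.2 hs])) (x := 0) ⟨by linarith, hB⟩ (abs_le.1 hA)
  rw [hv.1, sub_zero, Real.norm_eq_abs, Real.norm_eq_abs] at this
  have h2 : (2 * (|w₀.1| + B) ^ 3 + μ ^ 2 * B ^ 2 * (|w₀.1| + B)) * |A| ≤
    (2 * (|w₀.1| + B) ^ 3 + μ ^ 2 * B ^ 2 * (|w₀.1| + B)) * B := by gcongr
  linarith [abs_sub_abs_le_abs_sub (v A).2.1 w₀.2.1]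

theorem norm_le (hv : IsProfile μ b w₀ v) {A B : ℝ} (hA : |A| ≤ B) :
    ‖v A‖ ≤ ‖w₀‖ + B + (2 * (‖w₀‖ + B) ^ 3 + μ ^ 2 * B ^ 2 * (‖w₀‖ + B)) * B := by
  have hB : 0 ≤ B := (abs_nonneg A).trans hA
  have h1 : |w₀.1| ≤ ‖w₀‖ := norm_fst_le w₀
  have h2 : |w₀.2.1| ≤ ‖w₀‖ := (norm_fst_le w₀.2).trans (norm_snd_le w₀)
  have h3 : |w₀.2.2| ≤ ‖w₀‖ := (norm_snd_le w₀.2).trans (norm_snd_le w₀)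
  have h4 : 0 ≤ (2 * (‖w₀‖ + B) ^ 3 + μ ^ 2 * B ^ 2 * (‖w₀‖ + B)) * B := by positivity
  rw [Prod.norm_def, Prod.norm_def, hv.snd_snd]
  refine max_le ?_ (max_le ?_ ?_)
  · rw [Real.norm_eq_abs]; linarith [hv.abs_fst_le A]
  · rw [Real.norm_eq_abs]
    refine (hv.abs_snd_le hA).trans ?_
    have : (2 * (|w₀.1| + B) ^ 3 + μ ^ 2 * B ^ 2 * (|w₀.1| + B)) * B ≤
      (2 * (‖w₀‖ + B) ^ 3 + μ ^ 2 * B ^ 2 * (‖w₀‖ + B)) * B := by gcongr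
    linarith
  · rw [Real.norm_eq_abs]; linarith

/-- Continuous dependence on the initial value, jointly with the scale factor. -/
theorem continuousAt_family (hb : 0 ≤ b) {V : ℝ → ℝ → ℝ × ℝ × ℝ} {χ ϖ : ℝ}
    (hV : ∀ C, IsProfile μ b (χ, ϖ, C) (V C)) {C₀ A₀ : ℝ} (hA₀ : 0 < A₀) :
    ContinuousAt (fun z : ℝ × ℝ => V z.1 z.2) (C₀, A₀) := by
  set m := max |χ| (max |ϖ| (|C₀| + 1))
  set B := A₀ + 1
  set M := m + B + (2 * (m + B) ^ 3 + μ ^ 2 * B ^ 2 * (m + B)) * B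
  have hB : 0 < B := by positivity
  have hM : ∀ C, |C - C₀| ≤ 1 → ∀ A, |A| ≤ B → V C A ∈ Metric.closedBall (0 : ℝ × ℝ × ℝ) M := by
    intro C hC A hA
    rw [mem_closedBall_zero_iff]
    refine ((hV C).norm_le hA).trans ?_
    have : ‖(χ, ϖ, C)‖ ≤ m := by
      simp only [Prod.norm_def, Real.norm_eq_abs, m]
      gcongr
      linarith [abs_sub_abs_le_abs_sub C C₀]
    simp only [M]
    gcongr
  obtain ⟨K, hK⟩ := lipschitzOnBounded_ymField (μ := μ) hb M B
  have hdist : ∀ C, |C - C₀| ≤ 1 → ∀ A ∈ Set.Icc 0 B,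
      dist (V C A) (V C₀ A) ≤ |C - C₀| * Real.exp (K * B) := by
    intro C hC A hA
    have habs : ∀ s ∈ Set.Ico 0 B, |s| ≤ B := fun s hs => by
      rw [abs_of_nonneg hs.1]; exact hs.2.le
    have := dist_le_of_trajectories_ODE_of_mem (δ := |C - C₀|) (a := 0) (b := B) (K := K)
      (s := fun _ => Metric.closedBall 0 M) (v := ymField μ b)
      (fun s hs => hK s (habs s hs)) (hV C).continuous.continuousOn
      (fun s _ => ((hV C).2 s).hasDerivWithinAt) (fun s hs => hM C hC s (habs s hs))
      (hV C₀).continuous.continuousOn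
      (fun s _ => ((hV C₀).2 s).hasDerivWithinAt) (fun s hs => hM C₀ (by simp) s (habs s hs))
      (by rw [(hV C).1, (hV C₀).1]; simp [Prod.dist_eq, Real.dist_eq]) A hA
    refine this.trans ?_
    gcongr
    linarith [hA.2]
  rw [ContinuousAt, tendsto_iff_dist_tendsto_zero]
  have hlim : Tendsto (fun z : ℝ × ℝ => |z.1 - C₀| * Real.exp (K * B) +
      dist (V C₀ z.2) (V C₀ A₀)) (𝓝 (C₀, A₀)) (𝓝 0) := by
    have hc : Continuous fun z : ℝ × ℝ => |z.1 - C₀| * Real.exp (K * B) +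
      dist (V C₀ z.2) (V C₀ A₀) := by
      have := (hV C₀).continuous
      fun_prop
    exact hc.tendsto' _ _ (by simp)
  refine squeeze_zero' (Eventually.of_forall fun _ => dist_nonneg) ?_ hlim
  have e1 : ∀ᶠ z : ℝ × ℝ in 𝓝 (C₀, A₀), |z.1 - C₀| < 1 :=
    (by fun_prop : Continuous fun z : ℝ × ℝ => |z.1 - C₀|).continuousAt.eventually_lt
      continuousAt_const (by simp)
  have e2 : ∀ᶠ z : ℝ × ℝ in 𝓝 (C₀, A₀), z.2 < B :=
    continuousAt_snd.eventually_lt continuousAt_const (by simp [B])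
  have e3 : ∀ᶠ z : ℝ × ℝ in 𝓝 (C₀, A₀), 0 < z.2 :=
    continuousAt_const.eventually_lt continuousAt_snd hA₀
  filter_upwards [e1, e2, e3] with z h1 h2 h3
  exact (dist_triangle _ (V C₀ z.2) _).trans
    (by gcongr; exact hdist _ h1.le _ ⟨h3.le, h2.le⟩)

/-- The energy density of the Yang-Mills field changes only through the mass term. -/
theorem hasDerivAt_energy (hv : IsProfile μ b w₀ v) (A : ℝ) :
    HasDerivAt (fun s => (v s).2.1 ^ 2 + (v s).1 ^ 4 + μ ^ 2 * s ^ 2 * (v s).1 ^ 2)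
      (2 * μ ^ 2 * A * (v A).1 ^ 2) A := by
  have h := (((hv.hasDerivAt_snd A).pow 2).add ((hv.hasDerivAt_fst A).pow 4)).add
    (((hasDerivAt_id A).pow 2 |>.const_mul (μ ^ 2)).mul ((hv.hasDerivAt_fst A).pow 2))
  refine h.congr_deriv ?_
  simp
  ring

theorem monotoneOn_energy (hv : IsProfile μ b w₀ v) :
    MonotoneOn (fun s => (v s).2.1 ^ 2 + (v s).1 ^ 4 + μ ^ 2 * s ^ 2 * (v s).1 ^ 2)
      (Set.Ici 0) := by
  refine monotoneOn_of_deriv_nonneg (convex_Ici 0)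
    (fun A _ => (hv.hasDerivAt_energy A).continuousAt.continuousWithinAt)
    (fun A _ => (hv.hasDerivAt_energy A).differentiableAt.differentiableWithinAt) fun A hA => ?_
  rw [interior_Ici] at hA
  have : 0 < A := hA
  rw [(hv.hasDerivAt_energy A).deriv]
  positivity

theorem energy_ge (hv : IsProfile μ b w₀ v) {A : ℝ} (hA : 0 ≤ A) :
    w₀.2.1 ^ 2 + w₀.1 ^ 4 ≤ (v A).2.1 ^ 2 + (v A).1 ^ 4 + μ ^ 2 * A ^ 2 * (v A).1 ^ 2 := by
  simpa [hv.1] using hv.monotoneOn_energy Set.self_mem_Ici hA hA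

/-- The cut-off in `rate` is inactive if the initial rate is `1`. -/
theorem rate_sq (hb : 0 ≤ b) (hv : IsProfile μ b w₀ v) (hC : 0 ≤ w₀.2.2)
    (h0 : rateSq μ b 0 w₀ = 1) {A : ℝ} (hA : 0 ≤ A) :
    rate μ b A (v A) ^ 2 =
      (v A).2.1 ^ 2 + (v A).1 ^ 4 + μ ^ 2 * A ^ 2 * (v A).1 ^ 2 + w₀.2.2 * A ^ (2 * b) := by
  have h1 : rateSq μ b A (v A) = (v A).2.1 ^ 2 + (v A).1 ^ 4 + μ ^ 2 * A ^ 2 * (v A).1 ^ 2 +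
      w₀.2.2 * A ^ (2 * b) := by
    rw [rateSq, hv.snd_snd, abs_of_nonneg hA, abs_of_nonneg (by positivity)]
  rw [MassiveYM.rate_sq, h1]
  rw [h1]
  have h2 := hv.energy_ge hA
  have h3 : (0 : ℝ) ^ (2 * b) ≤ A ^ (2 * b) := Real.rpow_le_rpow le_rfl hA (by positivity)
  have h4 := mul_le_mul_of_nonneg_left h3 hC
  rw [rateSq, abs_zero, abs_of_nonneg (by positivity)] at h0
  linarith

theorem hasDerivAt_rate (hb : 0 ≤ b) (hv : IsProfile μ b w₀ v) (hC : 0 ≤ w₀.2.2)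
    (h0 : rateSq μ b 0 w₀ = 1) {A : ℝ} (hA : 0 < A) :
    HasDerivAt (fun s => rate μ b s (v s))
      ((μ ^ 2 * A ^ 2 * (v A).1 ^ 2 + b * (w₀.2.2 * A ^ (2 * b))) / (A * rate μ b A (v A))) A := by
  have hpos := rate_pos μ b A (v A)
  have h1 := (hv.hasDerivAt_energy A).add
    ((Real.hasDerivAt_rpow_const (p := 2 * b) (Or.inl hA.ne')).const_mul w₀.2.2)
  have h2 : HasDerivAt (fun s => rate μ b s (v s) ^ 2) _ A := h1.congr_of_eventuallyEq (by
    filter_upwards [lt_mem_nhds hA] with s hs using hv.rate_sq hb hC h0 hs.le)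
  have h3 := h2.sqrt (by positivity)
  have h4 : (fun s => √(rate μ b s (v s) ^ 2)) = fun s => rate μ b s (v s) :=
    funext fun s => Real.sqrt_sq (rate_pos μ b s (v s)).le
  rw [h4, Real.sqrt_sq hpos.le] at h3
  refine h3.congr_deriv ?_
  rw [Real.rpow_sub_one hA.ne']
  field_simp

end IsProfile

/-! ### From physical variables to states -/

/-- The state with scale factor `A`, expansion rate `r ^ 2`, potential `χ` and momentum `ϖ`. -/
def toState (μ A r χ ϖ : ℝ) : State :=
  ![ϖ / r ^ 2, χ / r, μ * (A / r) * (χ / r), A / (r + A)]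

variable {μ γm A r χ ϖ : ℝ}

theorem omegaYM_toState (hr : 0 < r) :
    OmegaYM (toState μ A r χ ϖ) = (ϖ ^ 2 + χ ^ 4 + μ ^ 2 * A ^ 2 * χ ^ 2) / r ^ 4 := by
  simp [OmegaYM, toState]
  field_simp

theorem toState_mem_stateSpace (hr : 0 < r) (hA : 0 < A)
    (hle : ϖ ^ 2 + χ ^ 4 + μ ^ 2 * A ^ 2 * χ ^ 2 ≤ r ^ 4) :
    toState μ A r χ ϖ ∈ stateSpace μ := by
  have h : 0 < r + A := by positivity
  refine ⟨?_, ?_, ?_, ?_, ?_⟩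
  · rw [omegaYM_toState hr]; positivity
  · rw [omegaYM_toState hr]; exact div_le_one_of_le₀ hle (by positivity)
  · simp only [toState, Matrix.cons_val]; positivity
  · simp only [toState, Matrix.cons_val]
    rw [div_lt_one h]; linarith
  · simp only [toState, Matrix.cons_val]
    field_simp
    ring

theorem toState_mem_mixedStates (hr : 0 < r) (hA : 0 < A)
    (hpos : 0 < ϖ ^ 2 + χ ^ 4 + μ ^ 2 * A ^ 2 * χ ^ 2)
    (hlt : ϖ ^ 2 + χ ^ 4 + μ ^ 2 * A ^ 2 * χ ^ 2 < r ^ 4) :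
    toState μ A r χ ϖ ∈ mixedStates μ := by
  refine ⟨toState_mem_stateSpace hr hA hlt.le, ?_, ?_⟩
  · rw [OmegaM, omegaYM_toState hr, sub_pos, div_lt_one (by positivity)]; exact hlt
  · rw [OmegaM, omegaYM_toState hr, sub_lt_self_iff]; positivity

theorem one_sub_q_toState {B : ℝ} (hr : 0 < r)
    (h4 : r ^ 4 = ϖ ^ 2 + χ ^ 4 + μ ^ 2 * A ^ 2 * χ ^ 2 + B) :
    1 - q γm (toState μ A r χ ϖ) =
      (μ ^ 2 * A ^ 2 * χ ^ 2 + fluidExp γm * B) / r ^ 4 := by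
  have h2 : toState μ A r χ ϖ 2 = μ * (A / r) * (χ / r) := rfl
  rw [one_sub_q, OmegaM, omegaYM_toState hr, h2]
  field_simp
  rw [h4]
  ring

/-- The Yang-Mills equation, the Friedmann equation and the choice of time `dA/dτ = (1 - T)² A`
imply the dimensionless evolution equations. -/
theorem hasDerivAt_toState {A r χ ϖ : ℝ → ℝ} {t : ℝ} (hr0 : 0 < r t) (hA0 : 0 < A t)
    (hA : HasDerivAt A ((r t / (r t + A t)) ^ 2 * A t) t)
    (hr : HasDerivAt r ((r t / (r t + A t)) ^ 2 *
      ((1 - q γm (toState μ (A t) (r t) (χ t) (ϖ t))) / 2 * r t)) t)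
    (hχ : HasDerivAt χ ((r t / (r t + A t)) ^ 2 * A t * (ϖ t / r t ^ 2)) t)
    (hϖ : HasDerivAt ϖ ((r t / (r t + A t)) ^ 2 * A t *
      (-(2 * χ t ^ 3 + μ ^ 2 * A t ^ 2 * χ t) / r t ^ 2)) t) :
    HasDerivAt (fun s => toState μ (A s) (r s) (χ s) (ϖ s))
      (vectorField μ γm (toState μ (A t) (r t) (χ t) (ϖ t))) t := by
  have h : 0 < r t + A t := by positivity
  have hv : ∀ x : State, vectorField μ γm x =
    ![-((1 - q γm x) * (1 - x 3) ^ 2 * x 0 + 2 * (1 - x 3) * x 3 * x 1 ^ 3 + μ * x 3 ^ 2 * x 2),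
      -(1 / 2) * ((1 - q γm x) * (1 - x 3) ^ 2 * x 1 - 2 * (1 - x 3) * x 3 * x 0),
      (1 - (1 - q γm x)) * (1 - x 3) ^ 2 * x 2 + μ * x 3 ^ 2 * x 0,
      1 / 2 * (2 - (1 - q γm x)) * (1 - x 3) ^ 3 * x 3] := by
    intro x
    simp only [vectorField]
    ring_nf
  rw [hv]
  generalize 1 - q γm (toState μ (A t) (r t) (χ t) (ϖ t)) = Q at *
  refine hasDerivAt_pi.2 fun i => ?_
  fin_cases i
  · refine (hϖ.div (hr.pow 2) (pow_ne_zero 2 hr0.ne')).congr_deriv ?_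
    simp [toState]
    field_simp
    ring
  · refine (hχ.div hr hr0.ne').congr_deriv ?_
    simp [toState]
    field_simp
    ring
  · refine (((hA.div hr hr0.ne').const_mul μ).mul (hχ.div hr hr0.ne')).congr_deriv ?_
    simp [toState]
    field_simp
    ring
  · refine (hA.div (hr.add hA) h.ne').congr_deriv ?_
    simp [toState]
    field_simp
    ring

/-! ### The solution of the system that belongs to a profile -/

/-- The state at scale factor `A` of the solution that belongs to the profile `v`. -/
def profileState (μ b : ℝ) (v : ℝ → ℝ × ℝ × ℝ) (A : ℝ) : State :=
  toState μ A (√(rate μ b A (v A))) (v A).1 (v A).2.1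

/-- The derivative of time with respect to `N = log A`, namely `(1 - T)⁻²`. -/
def clockRate (μ b : ℝ) (v : ℝ → ℝ × ℝ × ℝ) (N : ℝ) : ℝ :=
  ((√(rate μ b (Real.exp N) (v (Real.exp N))) + Real.exp N) /
    √(rate μ b (Real.exp N) (v (Real.exp N)))) ^ 2

/-- Time as a function of `N = log A`. -/
def clock (μ b : ℝ) (v : ℝ → ℝ × ℝ × ℝ) (N : ℝ) : ℝ :=
  ∫ s in (0 : ℝ)..N, clockRate μ b v s

theorem sqrt_rate_pos (μ b A : ℝ) (w : ℝ × ℝ × ℝ) : 0 < √(rate μ b A w) :=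
  Real.sqrt_pos.2 (rate_pos μ b A w)

theorem one_le_clockRate (μ b : ℝ) (v : ℝ → ℝ × ℝ × ℝ) (N : ℝ) : 1 ≤ clockRate μ b v N := by
  have h := sqrt_rate_pos μ b (Real.exp N) (v (Real.exp N))
  refine one_le_pow₀ ?_
  rw [one_le_div h]
  linarith [Real.exp_pos N]

namespace IsProfile

variable {b : ℝ} {w₀ : ℝ × ℝ × ℝ} {v : ℝ → ℝ × ℝ × ℝ}

theorem hasDerivAt_clock (hb : 0 ≤ b) (hv : IsProfile μ b w₀ v) (N : ℝ) :
    HasDerivAt (clock μ b v) (clockRate μ b v N) N := by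
  have h1 : Continuous fun s => √(rate μ b (Real.exp s) (v (Real.exp s))) :=
    ((hv.continuous_rate hb).comp Real.continuous_exp).sqrt
  have hc : Continuous (clockRate μ b v) :=
    ((h1.add Real.continuous_exp).div h1 fun s => (sqrt_rate_pos _ _ _ _).ne').pow 2
  exact intervalIntegral.integral_hasDerivAt_right (hc.intervalIntegrable _ _)
    (hc.stronglyMeasurableAtFilter _ _) hc.continuousAt

theorem monotone_clock_sub_id (hb : 0 ≤ b) (hv : IsProfile μ b w₀ v) :
    Monotone fun N => clock μ b v N - N := by
  have h : ∀ N, HasDerivAt (fun N => clock μ b v N - N) (clockRate μ b v N - 1) N := fun N =>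
    (hv.hasDerivAt_clock hb N).sub (hasDerivAt_id N)
  refine monotone_of_deriv_nonneg (fun N => (h N).differentiableAt) fun N => ?_
  rw [(h N).deriv]
  linarith [one_le_clockRate μ b v N]

/-- The clock expands distances. -/
theorem abs_sub_le_abs_clock_sub (hb : 0 ≤ b) (hv : IsProfile μ b w₀ v) (M N : ℝ) :
    |M - N| ≤ |clock μ b v M - clock μ b v N| := by
  have hm := hv.monotone_clock_sub_id hb
  rcases le_total M N with h | h
  · have := hm h
    simp only at this
    rw [abs_of_nonpos (by linarith), abs_of_nonpos (by linarith)]; linarith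
  · have := hm h
    simp only at this
    rw [abs_of_nonneg (by linarith), abs_of_nonneg (by linarith)]; linarith

theorem strictMono_clock (hb : 0 ≤ b) (hv : IsProfile μ b w₀ v) : StrictMono (clock μ b v) := by
  intro M N h
  have := hv.monotone_clock_sub_id hb h.le
  simp only at this
  linarith

theorem surjective_clock (hb : 0 ≤ b) (hv : IsProfile μ b w₀ v) :
    Function.Surjective (clock μ b v) := by
  have hc : Continuous (clock μ b v) :=
    continuous_iff_continuousAt.2 fun N => (hv.hasDerivAt_clock hb N).continuousAt
  have hm := hv.monotone_clock_sub_id hb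
  have h0 : clock μ b v 0 = 0 := by simp [clock]
  refine hc.surjective ?_ ?_
  · refine tendsto_atTop_mono' _ ?_ tendsto_id
    filter_upwards [eventually_ge_atTop 0] with N hN
    have := hm hN
    simp only [h0, id] at this ⊢
    linarith
  · refine tendsto_atBot_mono' _ ?_ tendsto_id
    filter_upwards [eventually_le_atBot 0] with N hN
    have := hm hN
    simp only [h0, id] at this ⊢
    linarith

/-- The logarithm of the scale factor as a function of time. -/
theorem exists_clock_inverse (hb : 0 ≤ b) (hv : IsProfile μ b w₀ v) :
    ∃ n : ℝ → ℝ, (∀ t, clock μ b v (n t) = t) ∧ (∀ N, n (clock μ b v N) = N) ∧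
      (∀ t, HasDerivAt n (clockRate μ b v (n t))⁻¹ t) ∧ Tendsto n atBot atBot := by
  let e := (hv.strictMono_clock hb).orderIsoOfSurjective _ (hv.surjective_clock hb)
  have h1 : ∀ t, clock μ b v (e.symm t) = t := e.apply_symm_apply
  refine ⟨e.symm, h1, e.symm_apply_apply, fun t => ?_, e.symm.tendsto_atBot⟩
  exact HasDerivAt.of_local_left_inverse e.symm.continuous.continuousAt
    (hv.hasDerivAt_clock hb _) (by linarith [one_le_clockRate μ b v (e.symm t)])
    (Eventually.of_forall h1)

theorem sqrt_rate_pow_four (hb : 0 ≤ b) (hv : IsProfile μ b w₀ v) (hC : 0 ≤ w₀.2.2)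
    (h0 : rateSq μ b 0 w₀ = 1) {A : ℝ} (hA : 0 ≤ A) :
    √(rate μ b A (v A)) ^ 4 =
      (v A).2.1 ^ 2 + (v A).1 ^ 4 + μ ^ 2 * A ^ 2 * (v A).1 ^ 2 + w₀.2.2 * A ^ (2 * b) := by
  rw [← hv.rate_sq hb hC h0 hA, show (4 : ℕ) = 2 * 2 from rfl, pow_mul,
    Real.sq_sqrt (rate_pos _ _ _ _).le]

theorem omegaM_profileState (hb : 0 ≤ b) (hv : IsProfile μ b w₀ v) (hC : 0 ≤ w₀.2.2)
    (h0 : rateSq μ b 0 w₀ = 1) {A : ℝ} (hA : 0 ≤ A) :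
    OmegaM (profileState μ b v A) = w₀.2.2 * A ^ (2 * b) / √(rate μ b A (v A)) ^ 4 := by
  have h := hv.sqrt_rate_pow_four hb hC h0 hA
  have hr := sqrt_rate_pos μ b A (v A)
  rw [OmegaM, profileState, omegaYM_toState hr, eq_div_iff (by positivity), sub_mul,
    div_mul_cancel₀ _ (by positivity)]
  linarith

theorem profileState_mem_stateSpace (hb : 0 ≤ b) (hv : IsProfile μ b w₀ v) (hC : 0 ≤ w₀.2.2)
    (h0 : rateSq μ b 0 w₀ = 1) {A : ℝ} (hA : 0 < A) :
    profileState μ b v A ∈ stateSpace μ := by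
  refine toState_mem_stateSpace (sqrt_rate_pos _ _ _ _) hA ?_
  rw [hv.sqrt_rate_pow_four hb hC h0 hA.le]
  have : 0 ≤ w₀.2.2 * A ^ (2 * b) := by positivity
  linarith

theorem profileState_mem_mixedStates (hb : 0 ≤ b) (hv : IsProfile μ b w₀ v) (hC : 0 < w₀.2.2)
    (h0 : rateSq μ b 0 w₀ = 1) (hpos : 0 < w₀.2.1 ^ 2 + w₀.1 ^ 4) {A : ℝ} (hA : 0 < A) :
    profileState μ b v A ∈ mixedStates μ := by
  refine toState_mem_mixedStates (sqrt_rate_pos _ _ _ _) hA (hpos.trans_le (hv.energy_ge hA.le)) ?_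
  rw [hv.sqrt_rate_pow_four hb hC.le h0 hA.le]
  have : 0 < w₀.2.2 * A ^ (2 * b) := by positivity
  linarith

theorem hasDerivAt_profileState (hb : 0 ≤ fluidExp γm) (hv : IsProfile μ (fluidExp γm) w₀ v)
    (hC : 0 ≤ w₀.2.2) (h0 : rateSq μ (fluidExp γm) 0 w₀ = 1) {n : ℝ → ℝ} {t : ℝ}
    (hn : HasDerivAt n (clockRate μ (fluidExp γm) v (n t))⁻¹ t) :
    HasDerivAt (fun s => profileState μ (fluidExp γm) v (Real.exp (n s)))
      (vectorField μ γm (profileState μ (fluidExp γm) v (Real.exp (n t)))) t := by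
  set b := fluidExp γm with hbdef
  have hA0 := Real.exp_pos (n t)
  have hr0 := sqrt_rate_pos μ b (Real.exp (n t)) (v (Real.exp (n t)))
  have h4 := hv.sqrt_rate_pow_four hb hC h0 hA0.le
  have hrr : √(rate μ b (Real.exp (n t)) (v (Real.exp (n t)))) ^ 2 =
      rate μ b (Real.exp (n t)) (v (Real.exp (n t))) := Real.sq_sqrt (rate_pos _ _ _ _).le
  have hA : HasDerivAt (fun s => Real.exp (n s))
      ((√(rate μ b (Real.exp (n t)) (v (Real.exp (n t)))) /
        (√(rate μ b (Real.exp (n t)) (v (Real.exp (n t)))) + Real.exp (n t))) ^ 2 *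
        Real.exp (n t)) t := by
    refine hn.exp.congr_deriv ?_
    rw [clockRate, ← inv_pow, inv_div, mul_comm]
  unfold profileState
  refine hasDerivAt_toState hr0 hA0 hA ?_ ?_ ?_
  · refine (((hv.hasDerivAt_rate hb hC h0 hA0).sqrt (rate_pos _ _ _ _).ne').comp t
      hA).congr_deriv ?_
    rw [one_sub_q_toState hr0 h4, ← hbdef]
    generalize √(rate μ b (Real.exp (n t)) (v (Real.exp (n t)))) = r at *
    rw [← hrr]
    field_simp
  · refine ((hv.hasDerivAt_fst _).comp t hA).congr_deriv ?_
    rw [hrr]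
    ring
  · refine ((hv.hasDerivAt_snd _).comp t hA).congr_deriv ?_
    rw [hrr]
    ring

theorem tendsto_profileState_zero (hb : 0 ≤ b) (hv : IsProfile μ b w₀ v)
    (h0 : rateSq μ b 0 w₀ = 1) :
    Tendsto (profileState μ b v) (𝓝 0) (𝓝 ![w₀.2.1, w₀.1, 0, 0]) := by
  have h1 := (hv.continuous_rate hb).sqrt
  have h2 := hv.continuous
  have hr0 : √(rate μ b 0 (v 0)) = 1 := by rw [hv.1, rate, h0]; simp
  have hc : ContinuousAt (profileState μ b v) 0 := by
    have h3 : ContinuousAt (fun A => √(rate μ b A (v A))) 0 := h1.continuousAt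
    have h4 : ContinuousAt v 0 := h2.continuousAt
    refine continuousAt_pi.2 fun i => ?_
    have e1 : √(rate μ b 0 (v 0)) ≠ 0 := by rw [hr0]; exact one_ne_zero
    have e2 : √(rate μ b 0 (v 0)) ^ 2 ≠ 0 := pow_ne_zero 2 e1
    have e3 : √(rate μ b 0 (v 0)) + 0 ≠ 0 := by rwa [add_zero]
    fin_cases i
    · exact h4.snd.fst.div (h3.pow 2) e2
    · exact h4.fst.div h3 e1
    · exact (continuousAt_const.mul (continuousAt_id.div h3 e1)).mul (h4.fst.div h3 e1)
    · exact continuousAt_id.div (h3.add continuousAt_id) e3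
  have hval : profileState μ b v 0 = ![w₀.2.1, w₀.1, 0, 0] := by
    rw [profileState, hr0, hv.1]
    simp [toState]
  rw [← hval]
  exact hc

theorem tendsto_profileState (hb : 0 ≤ b) (hv : IsProfile μ b w₀ v)
    (h0 : rateSq μ b 0 w₀ = 1) {n : ℝ → ℝ} (hn : Tendsto n atBot atBot) :
    Tendsto (fun t => profileState μ b v (Real.exp (n t))) atBot (𝓝 ![w₀.2.1, w₀.1, 0, 0]) :=
  (hv.tendsto_profileState_zero hb h0).comp (Real.tendsto_exp_atBot.comp hn)

end IsProfile

/-! ### From states to physical variables -/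

section Physical

variable {μ γm a : ℝ} {u : ℝ → State}

theorem one_sub_q_nonneg (hb : 0 ≤ fluidExp γm) {x : State} (hx : x ∈ stateSpace μ) :
    0 ≤ 1 - q γm x := by
  have := omegaM_nonneg hx
  rw [one_sub_q]; positivity

/-- The square root `r` of the expansion rate, normalized to `1` at the initial singularity, is
recovered from a solution by integrating `1 - q`. -/
theorem exists_sqrt_rate (hb : 0 ≤ fluidExp γm)
    (hu : IsSolutionOn μ γm (stateSpace μ) (Set.Iio a) u)
    (hq : PastBound (fun t => 1 - q γm (u t)) (a - 1)) :
    ∃ r : ℝ → ℝ, (∀ t < a, HasDerivAt r ((1 - u t 3) ^ 2 * ((1 - q γm (u t)) / 2 * r t)) t) ∧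
      (∀ t < a, 1 ≤ r t) ∧ Tendsto r atBot (𝓝 1) := by
  set g : ℝ → ℝ := fun t => (1 - u t 3) ^ 2 * ((1 - q γm (u t)) / 2)
  have huc : ContinuousOn u (Set.Iio a) := fun t ht => (hu t ht).2.continuousAt.continuousWithinAt
  have hgc : ContinuousOn g (Set.Iio a) := by
    have h1 : Continuous fun x : State => (1 - x 3) ^ 2 * ((1 - q γm x) / 2) := by
      unfold q OmegaM OmegaYM; fun_prop
    exact h1.comp_continuousOn huc
  have hg0 : ∀ t < a, 0 ≤ g t := fun t ht => by
    have := one_sub_q_nonneg hb (hu t ht).1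
    positivity
  have hF : ∀ t < a, HasDerivAt (fun t => ∫ s in (a - 1)..t, g s) (g t) t := by
    intro t ht
    refine intervalIntegral.integral_hasDerivAt_right
      (ContinuousOn.intervalIntegrable (hgc.mono ?_))
      (hgc.stronglyMeasurableAtFilter isOpen_Iio t ht) (hgc.continuousAt (Iio_mem_nhds ht))
    intro s hs
    exact hs.2.trans_lt (max_lt (by linarith) ht)
  have hmono := monotoneOn_Iio_of_hasDerivAt hF hg0
  obtain ⟨l, hl⟩ := hq.exists_tendsto (fun t ht => hF t (by linarith)) fun t ht => by
    have h1 := (hu t (Set.mem_Iio.2 (by linarith))).1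
    have h2 := one_sub_q_nonneg hb h1
    have h3 : (1 - u t 3) ^ 2 ≤ 1 :=
      pow_le_one₀ (by linarith [h1.2.2.2.1]) (by linarith [h1.2.2.1])
    rw [abs_of_nonneg (hg0 t (by linarith))]
    calc g t ≤ 1 * (1 - q γm (u t)) := by
          simp only [g]; gcongr; linarith
      _ = _ := one_mul _
  have hle : ∀ t < a, l ≤ ∫ s in (a - 1)..t, g s := fun t ht => by
    refine le_of_tendsto hl ?_
    filter_upwards [eventually_le_atBot t] with s hs
    exact hmono (Set.mem_Iio.2 (by linarith)) ht hs
  refine ⟨fun t => Real.exp ((∫ s in (a - 1)..t, g s) - l), fun t ht => ?_, fun t ht => ?_, ?_⟩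
  · refine ((hF t ht).sub_const l).exp.congr_deriv ?_
    simp only [g]
    ring
  · exact Real.one_le_exp (by linarith [hle t ht])
  · have h1 : Tendsto (fun t => (∫ s in (a - 1)..t, g s) - l) atBot (𝓝 0) := by
      simpa using hl.sub_const l
    simpa using h1.rexp

theorem toState_of_mem_stateSpace {x : State} (hx : x ∈ stateSpace μ) {r : ℝ} (hr : 0 < r) :
    toState μ (x 3 / (1 - x 3) * r) r (x 1 * r) (x 0 * r ^ 2) = x := by
  have hT : 0 < 1 - x 3 := by linarith [hx.2.2.2.1]
  have hy := comp_two_eq hx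
  funext i
  fin_cases i
  · simp [toState]; field_simp
  · simp [toState]; field_simp
  · simp only [toState]
    change μ * (x 3 / (1 - x 3) * r / r) * (x 1 * r / r) = x 2
    rw [hy]
    field_simp
  · simp only [toState]
    change x 3 / (1 - x 3) * r / (r + x 3 / (1 - x 3) * r) = x 3
    field_simp
    ring

/-- The physical variables `A`, `r`, `χ`, `ϖ` along a solution that converges to `p`, and the
evolution equations for `A`, `χ` and `ϖ`. The amount of fluid is a constant of the motion. -/
structure IsPhysical (μ b a : ℝ) (p : State) (C : ℝ) (u : ℝ → State) (A r χ ϖ : ℝ → ℝ) :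
    Prop where
  r_ge : ∀ t < a, 1 ≤ r t
  A_pos : ∀ t < a, 0 < A t
  eq_toState : ∀ t < a, u t = toState μ (A t) (r t) (χ t) (ϖ t)
  friedmann : ∀ t < a,
    r t ^ 4 = ϖ t ^ 2 + χ t ^ 4 + μ ^ 2 * A t ^ 2 * χ t ^ 2 + C * A t ^ (2 * b)
  deriv_A : ∀ t < a, HasDerivAt A ((r t / (r t + A t)) ^ 2 * A t) t
  deriv_χ : ∀ t < a, HasDerivAt χ ((r t / (r t + A t)) ^ 2 * A t * (ϖ t / r t ^ 2)) t
  deriv_ϖ : ∀ t < a, HasDerivAt ϖ ((r t / (r t + A t)) ^ 2 * A t *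
      (-(2 * χ t ^ 3 + μ ^ 2 * A t ^ 2 * χ t) / r t ^ 2)) t
  tendsto_A : Tendsto A atBot (𝓝 0)
  tendsto_r : Tendsto r atBot (𝓝 1)
  tendsto_χ : Tendsto χ atBot (𝓝 (p 1))
  tendsto_ϖ : Tendsto ϖ atBot (𝓝 (p 0))

theorem exists_isPhysical (hb : 0 ≤ fluidExp γm)
    (hu : IsSolutionOn μ γm (stateSpace μ) (Set.Iio a) u)
    (hq : PastBound (fun t => 1 - q γm (u t)) (a - 1)) {p : State} (hp3 : p 3 = 0)
    (hup : Tendsto u atBot (𝓝 p)) :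
    ∃ (C : ℝ) (A r χ ϖ : ℝ → ℝ), IsPhysical μ (fluidExp γm) a p C u A r χ ϖ ∧
      ∀ t < a, C = OmegaM (u t) * r t ^ 4 * A t ^ (-(2 * fluidExp γm)) := by
  obtain ⟨r, hr, hr1, hrl⟩ := exists_sqrt_rate hb hu hq
  set b := fluidExp γm with hbdef
  have hr0 : ∀ t < a, 0 < r t := fun t ht => one_pos.trans_le (hr1 t ht)
  have hT0 : ∀ t < a, 0 < u t 3 := fun t ht => (hu t ht).1.2.2.1
  have hT1 : ∀ t < a, 0 < 1 - u t 3 := fun t ht => by linarith [(hu t ht).1.2.2.2.1]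
  have hc : ∀ i, ∀ t < a, HasDerivAt (fun s => u s i) (vectorField μ γm (u t) i) t :=
    fun i t ht => hasDerivAt_comp (hu t ht).2 i
  set A : ℝ → ℝ := fun t => u t 3 / (1 - u t 3) * r t with hAdef
  have hA0 : ∀ t < a, 0 < A t := fun t ht => by
    have := hr0 t ht; have := hT0 t ht; have := hT1 t ht
    positivity
  have hθ : ∀ t < a, r t / (r t + A t) = 1 - u t 3 := fun t ht => by
    have h1 := hr0 t ht; have h2 := hT1 t ht; have h3 := hT0 t ht
    simp only [hAdef]
    rw [div_eq_iff (by positivity)]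
    field_simp
    ring
  have hA : ∀ t < a, HasDerivAt A ((1 - u t 3) ^ 2 * A t) t := fun t ht => by
    have h2 := (hT1 t ht).ne'
    refine (((hasDerivAt_T (hu t ht).2).div ((hasDerivAt_T (hu t ht).2).const_sub 1)
      h2).mul (hr t ht)).congr_deriv ?_
    simp only [hAdef, Pi.div_apply]
    field_simp
    ring
  have hconst : ∃ C, ∀ t < a, OmegaM (u t) * r t ^ 4 * A t ^ (-(2 * b)) = C := by
    have hd : ∀ t < a, HasDerivAt (fun t => OmegaM (u t) * r t ^ 4 * A t ^ (-(2 * b))) 0 t := by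
      intro t ht
      refine ((((hasDerivAt_omegaM (hu t ht).2).mul ((hr t ht).pow 4)).mul
        ((hA t ht).rpow_const (Or.inl (hA0 t ht).ne')))).congr_deriv ?_
      have hO : OmegaYM (u t) = 1 - OmegaM (u t) := by simp [OmegaM]
      have hA' := (hA0 t ht).ne'
      rw [one_sub_q, hO, ← hbdef, Real.rpow_sub_one hA']
      simp
      field_simp
      ring
    obtain ⟨C, hC⟩ := isOpen_Iio.exists_is_const_of_deriv_eq_zero
      (convex_Iio a).isPreconnected
      (fun t ht => (hd t ht).differentiableAt.differentiableWithinAt)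
      (fun t ht => (hd t ht).deriv)
    exact ⟨C, hC⟩
  obtain ⟨C, hC⟩ := hconst
  have hui : ∀ i, Tendsto (fun t => u t i) atBot (𝓝 (p i)) := tendsto_pi_nhds.1 hup
  have hs : ∀ t < a, u t = toState μ (A t) (r t) (u t 1 * r t) (u t 0 * r t ^ 2) := fun t ht =>
    (toState_of_mem_stateSpace (hu t ht).1 (hr0 t ht)).symm
  have hy : ∀ t < a, u t 2 = μ * (u t 3 / (1 - u t 3)) * u t 1 := fun t ht =>
    comp_two_eq (hu t ht).1
  refine ⟨C, A, r, fun t => u t 1 * r t, fun t => u t 0 * r t ^ 2,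
    ⟨hr1, hA0, hs, fun t ht => ?_, fun t ht => ?_, fun t ht => ?_, fun t ht => ?_, ?_, hrl, ?_, ?_⟩,
    fun t ht => (hC t ht).symm⟩
  · have h1 := hr0 t ht
    have h2 : OmegaM (u t) =
        1 - OmegaYM (toState μ (A t) (r t) (u t 1 * r t) (u t 0 * r t ^ 2)) := by
      rw [← hs t ht, OmegaM]
    rw [omegaYM_toState h1] at h2
    have h3 : C * A t ^ (2 * b) = OmegaM (u t) * r t ^ 4 := by
      rw [← hC t ht, Real.rpow_neg (hA0 t ht).le]
      have := Real.rpow_pos_of_pos (hA0 t ht) (2 * b)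
      field_simp
    rw [h3, h2]
    field_simp
    ring
  · rw [hθ t ht]; exact hA t ht
  · rw [hθ t ht]
    have h1 := (hr0 t ht).ne'; have h2 := (hT1 t ht).ne'
    refine ((hc 1 t ht).mul (hr t ht)).congr_deriv ?_
    simp only [vectorField, Matrix.cons_val, hAdef]
    field_simp
    ring
  · rw [hθ t ht]
    have h1 := (hr0 t ht).ne'; have h2 := (hT1 t ht).ne'
    refine ((hc 0 t ht).mul ((hr t ht).pow 2)).congr_deriv ?_
    simp only [vectorField, Matrix.cons_val_zero, hy t ht, hAdef]
    field_simp
    simp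
    ring
  · have h3 := hui 3
    rw [hp3] at h3
    simpa [hAdef] using (h3.div (h3.const_sub 1) (by norm_num)).mul hrl
  · simpa using (hui 1).mul hrl
  · simpa using (hui 0).mul (hrl.pow 2)

end Physical

/-! ### Solutions with given limit are given by profiles -/

section Uniqueness

variable {μ b a C : ℝ} {p : State} {u : ℝ → State} {A r χ ϖ : ℝ → ℝ}

namespace IsPhysical

theorem rateSq_eq_one (hb : 0 ≤ b) (hC : 0 ≤ C) (h : IsPhysical μ b a p C u A r χ ϖ) :
    rateSq μ b 0 (p 1, p 0, C) = 1 := by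
  have hpow : Tendsto (fun t => A t ^ (2 * b)) atBot (𝓝 (0 ^ (2 * b))) :=
    ((Real.continuous_rpow_const (by positivity : 0 ≤ 2 * b)).tendsto 0).comp h.tendsto_A
  have h1 := (((h.tendsto_ϖ.pow 2).add (h.tendsto_χ.pow 4)).add
    (((h.tendsto_A.pow 2).const_mul (μ ^ 2)).mul (h.tendsto_χ.pow 2))).add (hpow.const_mul C)
  have h2 := h.tendsto_r.pow 4
  have h3 := tendsto_nhds_unique (h2.congr' (by
    filter_upwards [eventually_lt_atBot a] with t ht using h.friedmann t ht)) h1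
  rw [rateSq, abs_zero, abs_of_nonneg (by positivity)]
  rw [← h3]
  norm_num

theorem rate_eq (hC : 0 ≤ C) (h : IsPhysical μ b a p C u A r χ ϖ) {t : ℝ} (ht : t < a) :
    rate μ b (A t) (χ t, ϖ t, C) = r t ^ 2 := by
  have hA := h.A_pos t ht
  have h1 : rateSq μ b (A t) (χ t, ϖ t, C) = (r t ^ 2) ^ 2 := by
    rw [rateSq, abs_of_pos hA, abs_of_nonneg (by positivity), ← pow_mul, h.friedmann t ht]
  have h2 : 1 ≤ r t ^ 2 := one_le_pow₀ (h.r_ge t ht)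
  rw [rate, h1, max_eq_right (one_le_pow₀ h2), Real.sqrt_sq (by positivity)]

/-- As functions of the scale factor, the physical variables of a solution agree with the profile
with the same value at the initial singularity. -/
theorem eq_profile (hb : 0 ≤ b) (hC : 0 ≤ C) (h : IsPhysical μ b a p C u A r χ ϖ)
    {v : ℝ → ℝ × ℝ × ℝ} (hv : IsProfile μ b (p 1, p 0, C) v) {t : ℝ} (ht : t < a) :
    v (A t) = (χ t, ϖ t, C) := by
  obtain ⟨a', hta', ha'⟩ := exists_between ht
  have hmono : MonotoneOn A (Set.Iio a) := monotoneOn_Iio_of_hasDerivAt h.deriv_A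
    fun s hs => by have := h.A_pos s hs; positivity
  have hA : ∀ s < a', |A s| ≤ A a' := fun s hs => by
    rw [abs_of_pos (h.A_pos s (hs.trans ha'))]
    exact hmono (hs.trans ha') ha' hs.le
  -- the curve converges at `-∞`, so it stays in a bounded set on `(-∞, a')`
  have hbdd : ∃ M, ∀ s < a', (χ s, ϖ s, C) ∈ Metric.closedBall (0 : ℝ × ℝ × ℝ) M := by
    have hχc : ContinuousOn χ (Set.Iio a) := fun s hs =>
      (h.deriv_χ s hs).continuousAt.continuousWithinAt
    have hϖc : ContinuousOn ϖ (Set.Iio a) := fun s hs =>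
      (h.deriv_ϖ s hs).continuousAt.continuousWithinAt
    have hlim : Tendsto (fun s => (χ s, ϖ s, C)) atBot (𝓝 (p 1, p 0, C)) :=
      h.tendsto_χ.prodMk_nhds (h.tendsto_ϖ.prodMk_nhds tendsto_const_nhds)
    obtain ⟨s₀, hs₀⟩ := eventually_atBot.1
      (hlim.eventually (Metric.closedBall_mem_nhds _ one_pos))
    have hK : IsCompact (Set.Icc (min s₀ a') a') := isCompact_Icc
    obtain ⟨M, hM⟩ := (hK.image_of_continuousOn (f := fun s => (χ s, ϖ s, C))
      ((hχc.prodMk (hϖc.prodMk continuousOn_const)).mono fun s hs =>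
        hs.2.trans_lt ha')).isBounded.exists_norm_le
    refine ⟨max M (‖(p 1, p 0, C)‖ + 1), fun s hs => ?_⟩
    rw [mem_closedBall_zero_iff]
    rcases le_total s s₀ with h1 | h1
    · have := hs₀ s h1
      rw [dist_eq_norm] at this
      refine le_max_of_le_right ?_
      linarith [norm_sub_norm_le (χ s, ϖ s, C) (p 1, p 0, C)]
    · exact le_max_of_le_left (hM _ ⟨s, ⟨min_le_of_left_le h1, hs.le⟩, rfl⟩)
  obtain ⟨M, hM⟩ := hbdd
  obtain ⟨M', hM'⟩ : ∃ M', ∀ s, |s| ≤ A a' → ‖v s‖ ≤ M' := ⟨_, fun s hs => hv.norm_le hs⟩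
  obtain ⟨K, hK⟩ := lipschitzOnBounded_ymField (μ := μ) hb (max M M') (A a')
  set f : ℝ → ℝ := fun s => (χ s - (v (A s)).1) ^ 2 + (ϖ s - (v (A s)).2.1) ^ 2
  have hd : ∀ s < a', HasDerivAt f
      (((r s / (r s + A s)) ^ 2 * A s) *
        (2 * (χ s - (v (A s)).1) *
          ((ymField μ b (A s) (χ s, ϖ s, C)).1 - (ymField μ b (A s) (v (A s))).1) +
        2 * (ϖ s - (v (A s)).2.1) *
          ((ymField μ b (A s) (χ s, ϖ s, C)).2.1 - (ymField μ b (A s) (v (A s))).2.1))) s := by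
    intro s hs
    have hs' := hs.trans ha'
    have h1 := (h.deriv_χ s hs').sub ((hv.hasDerivAt_fst _).comp s (h.deriv_A s hs'))
    have h2 := (h.deriv_ϖ s hs').sub ((hv.hasDerivAt_snd _).comp s (h.deriv_A s hs'))
    refine ((h1.pow 2).add (h2.pow 2)).congr_deriv ?_
    simp only [ymField, h.rate_eq hC hs']
    simp
    ring
  have hle : ∀ s < a', (((r s / (r s + A s)) ^ 2 * A s) *
        (2 * (χ s - (v (A s)).1) *
          ((ymField μ b (A s) (χ s, ϖ s, C)).1 - (ymField μ b (A s) (v (A s))).1) +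
        2 * (ϖ s - (v (A s)).2.1) *
          ((ymField μ b (A s) (χ s, ϖ s, C)).2.1 - (ymField μ b (A s) (v (A s))).2.1))) ≤
      4 * K * ((r s / (r s + A s)) ^ 2 * A s) * f s := by
    intro s hs
    have hA0 := h.A_pos s (hs.trans ha')
    have hK1 := (hK (A s) (hA s hs)).dist_le_mul (χ s, ϖ s, C)
      (Metric.closedBall_subset_closedBall (le_max_left _ _) (hM s hs)) (v (A s))
      (by rw [mem_closedBall_zero_iff]; exact (hM' _ (hA s hs)).trans (le_max_right _ _))
    simp only [Prod.dist_eq, Real.dist_eq, hv.snd_snd, sub_self, abs_zero] at hK1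
    simp only [f]
    generalize χ s - (v (A s)).1 = x at *
    generalize ϖ s - (v (A s)).2.1 = y at *
    generalize (ymField μ b (A s) (χ s, ϖ s, C)).1 - (ymField μ b (A s) (v (A s))).1 = x' at *
    generalize (ymField μ b (A s) (χ s, ϖ s, C)).2.1 - (ymField μ b (A s) (v (A s))).2.1 = y' at *
    have hm : max |x| (max |y| 0) ≤ |x| + |y| := by
      have := abs_nonneg x; have := abs_nonneg y
      exact max_le (by linarith) (max_le (by linarith) (by linarith))
    have hK2 := hK1.trans (mul_le_mul_of_nonneg_left hm K.2)
    have hx' : |x'| ≤ K * (|x| + |y|) := (le_max_left _ _).trans hK2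
    have hy' : |y'| ≤ K * (|x| + |y|) := (le_max_left _ _).trans ((le_max_right _ _).trans hK2)
    have e1 : x * x' ≤ |x| * (K * (|x| + |y|)) := (le_abs_self _).trans (by rw [abs_mul]; gcongr)
    have e2 : y * y' ≤ |y| * (K * (|x| + |y|)) := (le_abs_self _).trans (by rw [abs_mul]; gcongr)
    have e3 : (|x| + |y|) ^ 2 ≤ 2 * (x ^ 2 + y ^ 2) := by
      rw [← sq_abs x, ← sq_abs y]; nlinarith [sq_nonneg (|x| - |y|)]
    have e4 := mul_le_mul_of_nonneg_left e3 K.2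
    have e5 : 2 * x * x' + 2 * y * y' ≤ 4 * K * (x ^ 2 + y ^ 2) := by
      simp only [NNReal.val_eq_coe] at e4
      linarith
    have e6 : 0 ≤ (r s / (r s + A s)) ^ 2 * A s := by positivity
    linarith [mul_le_mul_of_nonneg_left e5 e6]
  have hf0 : Tendsto f atBot (𝓝 0) := by
    have hvA : Tendsto (fun s => v (A s)) atBot (𝓝 (p 1, p 0, C)) := by
      rw [← hv.1]; exact (hv.continuous.tendsto 0).comp h.tendsto_A
    simpa using ((h.tendsto_χ.sub hvA.fst_nhds).pow 2).add
      ((h.tendsto_ϖ.sub hvA.snd_nhds.fst_nhds).pow 2)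
  have hzero := eq_zero_of_deriv_le_of_tendsto_atBot hd
    (fun s hs => h.deriv_A s (hs.trans ha')) (fun s _ => by positivity) hle hf0 h.tendsto_A t hta'
  have z1 := sq_nonneg (χ t - (v (A t)).1)
  have z2 := sq_nonneg (ϖ t - (v (A t)).2.1)
  simp only [f] at hzero
  have z3 : χ t - (v (A t)).1 = 0 := by rw [← sq_eq_zero_iff]; linarith
  have z4 : ϖ t - (v (A t)).2.1 = 0 := by rw [← sq_eq_zero_iff]; linarith
  refine Prod.ext ?_ (Prod.ext ?_ (hv.snd_snd _))
  · simp only; linarith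
  · simp only; linarith

/-- A solution with limit `p` is, up to a translation in time, the solution that belongs to the
profile. -/
theorem exists_eq_profileState (hb : 0 ≤ b) (hC : 0 ≤ C) (h : IsPhysical μ b a p C u A r χ ϖ)
    {v : ℝ → ℝ × ℝ × ℝ} (hv : IsProfile μ b (p 1, p 0, C) v) {n : ℝ → ℝ}
    (hn : ∀ N, n (clock μ b v N) = N) :
    ∃ s, ∀ t < a, u t = profileState μ b v (Real.exp (n (t + s))) := by
  have hr : ∀ t < a, √(rate μ b (A t) (v (A t))) = r t := fun t ht => by
    rw [h.eq_profile hb hC hv ht, h.rate_eq hC ht,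
      Real.sqrt_sq (by linarith [h.r_ge t ht])]
  have hd : ∀ t < a, HasDerivAt (fun t => clock μ b v (Real.log (A t)) - t) 0 t := by
    intro t ht
    have hA := h.A_pos t ht
    have hr1 := h.r_ge t ht
    have h1 : HasDerivAt (fun t => clock μ b v (Real.log (A t))) _ t :=
      (hv.hasDerivAt_clock hb _).comp t ((h.deriv_A t ht).log hA.ne')
    refine (h1.sub (hasDerivAt_id t)).congr_deriv ?_
    rw [clockRate, Real.exp_log hA, hr t ht]
    field_simp
    ring
  obtain ⟨s, hs⟩ := isOpen_Iio.exists_is_const_of_deriv_eq_zero (convex_Iio a).isPreconnected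
    (fun t ht => (hd t ht).differentiableAt.differentiableWithinAt) (fun t ht => (hd t ht).deriv)
  refine ⟨s, fun t ht => ?_⟩
  have h1 : t + s = clock μ b v (Real.log (A t)) := by linarith [hs t ht]
  rw [h1, hn, Real.exp_log (h.A_pos t ht), profileState, hr t ht, h.eq_profile hb hC hv ht]
  exact h.eq_toState t ht

end IsPhysical

end Uniqueness

/-! ### Uniqueness for the autonomous system -/

theorem exists_lipschitzOnWith_vectorField (μ γm : ℝ) :
    ∃ K, LipschitzOnWith K (vectorField μ γm) (Metric.closedBall 0 1) := by
  have h : ContDiff ℝ 1 (vectorField μ γm) := by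
    refine contDiff_pi.2 fun i => ?_
    unfold vectorField q OmegaM OmegaYM
    fin_cases i
    all_goals
      simp only [Fin.zero_eta, Fin.mk_one, Fin.reduceFinMk, Matrix.cons_val]
      fun_prop
  exact h.contDiffOn.exists_lipschitzOnWith one_ne_zero (convex_closedBall 0 1)
    (isCompact_closedBall 0 1)

theorem stateSpace_subset_closedBall (μ : ℝ) : stateSpace μ ⊆ Metric.closedBall 0 1 := by
  intro x hx
  rw [mem_closedBall_zero_iff, pi_norm_le_iff_of_nonneg zero_le_one]
  obtain ⟨h0, h1, h2⟩ := abs_comp_le hx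
  intro i
  fin_cases i
  exacts [h0, h1, h2, by
    change |x 3| ≤ 1
    rw [abs_of_pos hx.2.2.1]; exact hx.2.2.2.1.le]

theorem IsSolutionOn.eq_of_eq {μ γm : ℝ} {u v : ℝ → State}
    (hu : IsSolutionOn μ γm (stateSpace μ) Set.univ u)
    (hv : IsSolutionOn μ γm (stateSpace μ) Set.univ v) {s t : ℝ} (h : u s = v t) (τ : ℝ) :
    u (τ + s) = v (τ + t) := by
  obtain ⟨K, hK⟩ := exists_lipschitzOnWith_vectorField μ γm
  have key := ODE_solution_unique_univ (v := fun _ => vectorField μ γm)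
    (s := fun _ => Metric.closedBall 0 1) (K := K) (f := fun τ => u (τ + s))
    (g := fun τ => v (τ + t)) (t₀ := 0) (fun _ => hK)
    (fun τ => ⟨(hu (τ + s) trivial).2.comp_add_const τ s,
      stateSpace_subset_closedBall μ (hu (τ + s) trivial).1⟩)
    (fun τ => ⟨(hv (τ + t) trivial).2.comp_add_const τ t,
      stateSpace_subset_closedBall μ (hv (τ + t) trivial).1⟩) (by simpa using h)
  exact congrFun key τ

theorem strictMono_T {μ γm : ℝ} (hγ : 0 < γm) {u : ℝ → State}
    (hu : IsSolutionOn μ γm (stateSpace μ) Set.univ u) : StrictMono fun t => u t 3 := by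
  obtain ⟨k, hk, hkq⟩ := exists_pos_le_one_add_q (γm := γm) μ hγ
  refine strictMono_of_deriv_pos fun t => ?_
  obtain ⟨h1, h2⟩ := hu t trivial
  rw [(hasDerivAt_T h2).deriv]
  have h3 := hkq _ h1
  have h4 : 0 < 1 + q γm (u t) := by linarith
  have h5 := h1.2.2.1
  have h6 : 0 < 1 - u t 3 := by linarith [h1.2.2.2.1]
  positivity

/-! ### Radiation -/

section Radiation

variable {μ γm : ℝ} {p : State}

theorem eq_vec_of_comp_eq_zero (h2 : p 2 = 0) (h3 : p 3 = 0) : ![p 0, p 1, 0, 0] = p := by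
  funext i
  fin_cases i <;> simp [h2, h3]

theorem fluidExp_four_thirds : fluidExp (4 / 3) = 0 := by norm_num [fluidExp]

theorem omegaM_eq_of_mem_diskDR (hp : p ∈ diskDR) : OmegaM p = 1 - (p 0 ^ 2 + p 1 ^ 4) := by
  simp [OmegaM, OmegaYM, hp.2.2.2]

theorem rateSq_zero_radiation (hp : p ∈ diskDR) :
    rateSq μ (fluidExp (4 / 3)) 0 (p 1, p 0, OmegaM p) = 1 := by
  have h : 0 ≤ OmegaM p := by rw [omegaM_eq_of_mem_diskDR hp]; linarith [hp.2.1]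
  rw [rateSq, fluidExp_four_thirds, mul_zero, Real.rpow_zero, mul_one, abs_of_nonneg h,
    omegaM_eq_of_mem_diskDR hp]
  ring

/-- For radiation, the amount of fluid is determined by the limit. -/
theorem exists_isPhysical_radiation (hp : p ∈ diskDR) {a : ℝ} {u : ℝ → State}
    (hu : IsSolutionOn μ (4 / 3) (stateSpace μ) (Set.Iio a) u) (hup : Tendsto u atBot (𝓝 p)) :
    ∃ A r χ ϖ : ℝ → ℝ, IsPhysical μ (fluidExp (4 / 3)) a p (OmegaM p) u A r χ ϖ ∧
      ∀ t < a, OmegaM p = OmegaM (u t) * r t ^ 4 := by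
  have hb := fluidExp_four_thirds
  have hγ : (0 : ℝ) < 4 / 3 := by norm_num
  obtain ⟨C, A, r, χ, ϖ, h, hC⟩ := exists_isPhysical hb.ge hu
    (pastBound_one_sub_q_of_eq_zero hγ hb hu) hp.2.2.1 hup
  simp only [hb, mul_zero, neg_zero, Real.rpow_zero, mul_one] at hC
  have hC0 : 0 ≤ C := by
    have ht : a - 1 < a := by linarith
    have := omegaM_nonneg (hu _ ht).1
    have := h.r_ge _ ht
    rw [hC _ ht]
    positivity
  have h1 := h.rateSq_eq_one hb.ge hC0
  rw [rateSq, hb, mul_zero, Real.rpow_zero, mul_one, abs_of_nonneg hC0] at h1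
  have h2 : C = OmegaM p := by rw [omegaM_eq_of_mem_diskDR hp]; simp only at h1; linarith
  subst h2
  exact ⟨A, r, χ, ϖ, h, hC⟩

theorem isAlphaLimitOfUniqueSolution_radiation (hp : p ∈ diskDR) {S : Set State}
    (hS : S ⊆ stateSpace μ)
    (hmem : ∀ v, IsProfile μ (fluidExp (4 / 3)) (p 1, p 0, OmegaM p) v → ∀ A > 0,
      profileState μ (fluidExp (4 / 3)) v A ∈ S) :
    IsAlphaLimitOfUniqueSolution μ (4 / 3) S p := by
  have hb := fluidExp_four_thirds
  have h0 := rateSq_zero_radiation (μ := μ) hp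
  have hC : 0 ≤ OmegaM p := by rw [omegaM_eq_of_mem_diskDR hp]; linarith [hp.2.1]
  obtain ⟨v, hv⟩ := exists_isProfile (μ := μ) hb.ge (p 1, p 0, OmegaM p)
  obtain ⟨n, -, hn, hnd, hnl⟩ := hv.exists_clock_inverse hb.ge
  refine ⟨fun t => profileState μ (fluidExp (4 / 3)) v (Real.exp (n t)), fun t _ =>
    ⟨hmem v hv _ (Real.exp_pos _), hv.hasDerivAt_profileState hb.ge hC h0 (hnd t)⟩, ?_, ?_⟩
  · have := hv.tendsto_profileState hb.ge h0 hnl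
    rwa [eq_vec_of_comp_eq_zero hp.2.2.2 hp.2.2.1] at this
  · intro a u hu hup
    obtain ⟨A, r, χ, ϖ, h, -⟩ := exists_isPhysical_radiation hp (hu.mono hS subset_rfl) hup
    exact h.exists_eq_profileState hb.ge hC hv hn

theorem isAlphaLimitOfUniqueSolution_stateSpace (hp : p ∈ diskDR) :
    IsAlphaLimitOfUniqueSolution μ (4 / 3) (stateSpace μ) p := by
  have hC : 0 ≤ OmegaM p := by rw [omegaM_eq_of_mem_diskDR hp]; linarith [hp.2.1]
  exact isAlphaLimitOfUniqueSolution_radiation hp subset_rfl fun v hv A hA =>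
    hv.profileState_mem_stateSpace fluidExp_four_thirds.ge hC (rateSq_zero_radiation hp) hA

/-- The vacuum field: if the field vanishes at the initial singularity, it vanishes identically. -/
theorem isProfile_zero (μ b C : ℝ) : IsProfile μ b (0, 0, C) fun _ => (0, 0, C) := by
  refine ⟨rfl, fun A => ?_⟩
  have : ymField μ b A (0, 0, C) = 0 := by simp [ymField]
  rw [this]
  exact hasDerivAt_const A _

theorem isAlphaLimitOfUniqueSolution_mixedStates_iff (hp : p ∈ diskDR) :
    (0 < OmegaM p ∧ OmegaM p < 1) ↔
      IsAlphaLimitOfUniqueSolution μ (4 / 3) (mixedStates μ) p := by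
  have hb := fluidExp_four_thirds
  have hO := omegaM_eq_of_mem_diskDR hp
  constructor
  · rintro ⟨h0, h1⟩
    refine isAlphaLimitOfUniqueSolution_radiation hp (mixedStates_subset μ) fun v hv A hA => ?_
    exact hv.profileState_mem_mixedStates hb.ge h0 (rateSq_zero_radiation hp)
      (by simp only; linarith) hA
  · rintro ⟨u, hu, hup, -⟩
    have hu0 := hu.mono (subset_refl (mixedStates μ)) (Set.subset_univ (Set.Iio 0))
    obtain ⟨A, r, χ, ϖ, h, hC⟩ := exists_isPhysical_radiation hp
      (hu0.mono (mixedStates_subset μ) subset_rfl) hup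
    have ht : (-1 : ℝ) < 0 := by norm_num
    obtain ⟨-, hm0, hm1⟩ := (hu0 (-1) ht).1
    have hr := h.r_ge (-1) ht
    have hpos : 0 < OmegaM p := by rw [hC (-1) ht]; positivity
    refine ⟨hpos, lt_of_not_ge fun hge => ?_⟩
    -- `Ω_m(p) = 1` means that `p` is the origin
    have hp1 : p 1 = 0 := by
      have h4 : p 1 ^ 4 = 0 := le_antisymm (by nlinarith [sq_nonneg (p 0)]) (by positivity)
      exact pow_eq_zero_iff (by norm_num) |>.1 h4
    have hp0 : p 0 = 0 := by
      have h2 : p 0 ^ 2 = 0 := le_antisymm (by nlinarith [sq_nonneg (p 1 ^ 2)]) (by positivity)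
      exact pow_eq_zero_iff (by norm_num) |>.1 h2
    have hv := isProfile_zero μ (fluidExp (4 / 3)) (OmegaM p)
    rw [show ((0 : ℝ), (0 : ℝ), OmegaM p) = (p 1, p 0, OmegaM p) by rw [hp1, hp0]] at hv
    have hz := h.eq_profile hb.ge hpos.le hv ht
    simp only [hp1, hp0, Prod.mk.injEq, and_true] at hz
    rw [h.eq_toState (-1) ht, ← hz.1, ← hz.2, OmegaM, omegaYM_toState (by linarith)] at hm1
    norm_num at hm1

end Radiation

/-! ### The plane of solutions with a given limit on the circle -/

/-- A continuous injection is an embedding if the preimages of small sets are contained in compact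
sets. -/
theorem isEmbedding_of_preimage_subset_compact {X Y : Type*} [TopologicalSpace X]
    [TopologicalSpace Y] [T2Space Y] {f : X → Y} (hf : Continuous f)
    (hinj : Function.Injective f)
    (hK : ∀ x, ∃ K, IsCompact K ∧ ∃ S ∈ 𝓝 (f x), f ⁻¹' S ⊆ K) : IsEmbedding f := by
  refine ⟨isInducing_iff_nhds.2 fun x => le_antisymm (hf.tendsto x).le_comap ?_, hinj⟩
  rw [le_iff_ultrafilter]
  intro U hU
  have hUx : Tendsto f U (𝓝 (f x)) := tendsto_iff_comap.2 hU
  obtain ⟨K, hKc, S, hS, hSK⟩ := hK x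
  obtain ⟨y, -, hy⟩ := hKc.ultrafilter_le_nhds U
    (le_principal_iff.2 (mem_of_superset (hUx hS) hSK))
  have : f y = f x := tendsto_nhds_unique ((hf.tendsto y).mono_left hy) hUx
  rwa [hinj this] at hy

section Circle

variable {μ b : ℝ} {w₀ : ℝ × ℝ × ℝ} {v : ℝ → ℝ × ℝ × ℝ}

/-- The energy of the Yang-Mills field is controlled by the state: along a profile
`log E - 2 μ² A² / √E` is decreasing. -/
theorem IsProfile.log_energy_le (hv : IsProfile μ b w₀ v) (h1 : w₀.2.1 ^ 2 + w₀.1 ^ 4 = 1) {A : ℝ}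
    (hA : 0 ≤ A) :
    Real.log ((v A).2.1 ^ 2 + (v A).1 ^ 4 + μ ^ 2 * A ^ 2 * (v A).1 ^ 2) ≤
      2 * μ ^ 2 * (A ^ 2 / √((v A).2.1 ^ 2 + (v A).1 ^ 4 + μ ^ 2 * A ^ 2 * (v A).1 ^ 2)) := by
  set E : ℝ → ℝ := fun s => (v s).2.1 ^ 2 + (v s).1 ^ 4 + μ ^ 2 * s ^ 2 * (v s).1 ^ 2 with hE
  have hEpos : ∀ s, 0 ≤ s → 0 < E s := fun s hs => by
    have := hv.energy_ge hs
    simp only [hE]; linarith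
  have hd : ∀ s, 0 ≤ s → HasDerivAt (fun s => Real.log (E s) - 2 * μ ^ 2 * (s ^ 2 / √(E s)))
      (2 * μ ^ 2 * s * (v s).1 ^ 2 / E s - 2 * μ ^ 2 *
        ((2 * s * √(E s) - s ^ 2 * (2 * μ ^ 2 * s * (v s).1 ^ 2 / (2 * √(E s)))) / √(E s) ^ 2))
      s := fun s hs => by
    have h := hv.hasDerivAt_energy s
    have h2 := hEpos s hs
    refine ((h.log h2.ne').sub ((((hasDerivAt_id s).pow 2).div (h.sqrt h2.ne')
      (Real.sqrt_pos.2 h2).ne').const_mul _)).congr_deriv ?_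
    simp [hE]
  have hanti : AntitoneOn (fun s => Real.log (E s) - 2 * μ ^ 2 * (s ^ 2 / √(E s)))
      (Set.Ici 0) := by
    refine antitoneOn_of_deriv_nonpos (convex_Ici 0)
      (fun s hs => (hd s hs).continuousAt.continuousWithinAt) (fun s hs => ?_) fun s hs => ?_
    · rw [interior_Ici] at hs
      exact (hd s (le_of_lt hs)).differentiableAt.differentiableWithinAt
    · rw [interior_Ici] at hs
      have hs0 : 0 < s := hs
      rw [(hd s hs0.le).deriv]
      have h2 := Real.sqrt_pos.2 (hEpos s hs0.le)
      have h3 := Real.sq_sqrt (hEpos s hs0.le).le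
      have h4 : (v s).1 ^ 2 ≤ √(E s) := by
        refine Real.le_sqrt_of_sq_le ?_
        simp only [hE]
        have : 0 ≤ (v s).2.1 ^ 2 + μ ^ 2 * s ^ 2 * (v s).1 ^ 2 := by positivity
        nlinarith
      have h5 : μ ^ 2 * s ^ 2 * (v s).1 ^ 2 ≤ √(E s) ^ 2 := by
        rw [h3]
        simp only [hE]
        have : 0 ≤ (v s).2.1 ^ 2 + (v s).1 ^ 4 := by positivity
        linarith
      generalize √(E s) = e at *
      rw [← h3]
      generalize (v s).1 ^ 2 = y at *
      have : 2 * μ ^ 2 * s * y / e ^ 2 - 2 * μ ^ 2 *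
          ((2 * s * e - s ^ 2 * (2 * μ ^ 2 * s * y / (2 * e))) / e ^ 2) =
          2 * μ ^ 2 * s / e ^ 3 * (e * (y - e) + (μ ^ 2 * s ^ 2 * y - e ^ 2)) := by
        field_simp
        ring
      rw [this]
      exact mul_nonpos_of_nonneg_of_nonpos (by positivity) (by nlinarith)
  have h := hanti Set.self_mem_Ici hA hA
  have hE0 : E 0 = 1 := by simp [hE, hv.1, h1]
  simp only [hE0, Real.log_one] at h
  norm_num at h
  exact h

/-- The invariant `Ω_m h ^ (-2b)`, `h = T / (1 - T)`, tends to the amount of fluid at the initial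
singularity. -/
theorem IsProfile.tendsto_invariant (hb : 0 ≤ b) (hv : IsProfile μ b w₀ v) (hC : 0 ≤ w₀.2.2)
    (h0 : rateSq μ b 0 w₀ = 1) :
    Tendsto (fun A => OmegaM (profileState μ b v A) *
      (profileState μ b v A 3 / (1 - profileState μ b v A 3)) ^ (-(2 * b))) (𝓝[>] 0)
      (𝓝 w₀.2.2) := by
  have hr : Tendsto (fun A => √(rate μ b A (v A))) (𝓝[>] 0) (𝓝 1) := by
    have := (hv.continuous_rate hb).sqrt.tendsto 0
    rw [hv.1, rate, h0, max_self, Real.sqrt_one, Real.sqrt_one] at this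
    exact this.mono_left nhdsWithin_le_nhds
  have hlim : Tendsto (fun A => w₀.2.2 * (√(rate μ b A (v A)) ^ (2 * b) /
      √(rate μ b A (v A)) ^ 4)) (𝓝[>] 0) (𝓝 w₀.2.2) := by
    simpa using ((hr.rpow_const (p := 2 * b) (Or.inl one_ne_zero)).div (hr.pow 4)
      (by norm_num)).const_mul w₀.2.2
  refine hlim.congr' ?_
  filter_upwards [self_mem_nhdsWithin] with A hA
  have hA0 : 0 < A := hA
  have hr0 := sqrt_rate_pos μ b A (v A)
  rw [hv.omegaM_profileState hb hC h0 hA0.le]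
  have h3 : profileState μ b v A 3 / (1 - profileState μ b v A 3) =
      A / √(rate μ b A (v A)) := by
    change A / (√(rate μ b A (v A)) + A) / (1 - A / (√(rate μ b A (v A)) + A)) = _
    have : √(rate μ b A (v A)) + A ≠ 0 := by positivity
    rw [one_sub_div this, add_sub_cancel_right]
    field_simp
  rw [h3, Real.rpow_neg (by positivity), Real.div_rpow hA0.le hr0.le]
  have := Real.rpow_pos_of_pos hA0 (2 * b)
  have := Real.rpow_pos_of_pos hr0 (2 * b)
  field_simp

theorem rateSq_zero_circle (hb : 0 < b) {p : State} (hp : p ∈ circleLR) (C : ℝ) :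
    rateSq μ b 0 (p 1, p 0, C) = 1 := by
  simp only [rateSq, abs_zero, Real.zero_rpow (by positivity : 2 * b ≠ 0), mul_zero]
  linarith [hp.1]

/-- The states of the solutions with limit `p`, parametrized by the logarithms `c` of the amount of
fluid and `N` of the scale factor. -/
def planeMap (μ b : ℝ) (V : ℝ → ℝ → ℝ × ℝ × ℝ) (z : ℝ × ℝ) : State :=
  profileState μ b (V (Real.exp z.1)) (Real.exp z.2)

variable {V : ℝ → ℝ → ℝ × ℝ × ℝ} {x y : ℝ}

theorem continuous_family_exp (hb : 0 ≤ b) (hV : ∀ C, IsProfile μ b (x, y, C) (V C)) :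
    Continuous fun z : ℝ × ℝ => V (Real.exp z.1) (Real.exp z.2) := by
  refine continuous_iff_continuousAt.2 fun z => ?_
  have h := IsProfile.continuousAt_family hb hV (C₀ := Real.exp z.1) (Real.exp_pos z.2)
  exact ContinuousAt.comp (f := fun z : ℝ × ℝ => (Real.exp z.1, Real.exp z.2)) h (by fun_prop)

theorem continuous_sqrt_rate_exp (hb : 0 ≤ b) (hV : ∀ C, IsProfile μ b (x, y, C) (V C)) :
    Continuous fun z : ℝ × ℝ => √(rate μ b (Real.exp z.2) (V (Real.exp z.1) (Real.exp z.2))) :=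
  ((continuous_rate hb).comp ((Real.continuous_exp.comp continuous_snd).prodMk
    (continuous_family_exp hb hV))).sqrt

theorem continuous_planeMap (hb : 0 ≤ b) (hV : ∀ C, IsProfile μ b (x, y, C) (V C)) :
    Continuous (planeMap μ b V) := by
  have h1 := continuous_family_exp hb hV
  have h2 := continuous_sqrt_rate_exp hb hV
  have h3 : ∀ z : ℝ × ℝ, √(rate μ b (Real.exp z.2) (V (Real.exp z.1) (Real.exp z.2))) ≠ 0 :=
    fun z => (sqrt_rate_pos _ _ _ _).ne'
  have hA : Continuous fun z : ℝ × ℝ => Real.exp z.2 := by fun_prop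
  refine continuous_pi fun i => ?_
  fin_cases i
  · exact h1.snd.fst.div (h2.pow 2) fun z => pow_ne_zero 2 (h3 z)
  · exact h1.fst.div h2 h3
  · exact (continuous_const.mul (hA.div h2 h3)).mul (h1.fst.div h2 h3)
  · exact hA.div (h2.add hA) fun z =>
      (add_pos (sqrt_rate_pos _ _ _ _) (Real.exp_pos _)).ne'

theorem continuous_primitive_of_continuous {F : ℝ → ℝ → ℝ}
    (hF : Continuous fun z : ℝ × ℝ => F z.1 z.2) :
    Continuous fun z : ℝ × ℝ => ∫ s in (0 : ℝ)..z.2, F z.1 s := by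
  have hf : Continuous (Function.uncurry fun (z : ℝ × ℝ) s => F z.1 s) :=
    hF.comp (by fun_prop : Continuous fun w : (ℝ × ℝ) × ℝ => (w.1.1, w.2))
  exact intervalIntegral.continuous_parametric_intervalIntegral_of_continuous hf continuous_snd

theorem continuous_clock (hb : 0 ≤ b) (hV : ∀ C, IsProfile μ b (x, y, C) (V C)) :
    Continuous fun z : ℝ × ℝ => clock μ b (V (Real.exp z.1)) z.2 := by
  have h2 := continuous_sqrt_rate_exp hb hV
  have h : Continuous fun z : ℝ × ℝ => clockRate μ b (V (Real.exp z.1)) z.2 :=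
    ((h2.add (by fun_prop)).div h2 fun z => (sqrt_rate_pos _ _ _ _).ne').pow 2
  exact continuous_primitive_of_continuous (F := fun c s => clockRate μ b (V (Real.exp c)) s) h

/-- Passing from the logarithm of the scale factor to time, on all orbits simultaneously. -/
def clockHomeomorph (hb : 0 ≤ b) (hV : ∀ C, IsProfile μ b (x, y, C) (V C)) {n : ℝ → ℝ → ℝ}
    (hn₁ : ∀ c t, clock μ b (V (Real.exp c)) (n c t) = t)
    (hn₂ : ∀ c N, n c (clock μ b (V (Real.exp c)) N) = N) : (ℝ × ℝ) ≃ₜ (ℝ × ℝ) where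
  toFun z := (z.1, n z.1 z.2)
  invFun z := (z.1, clock μ b (V (Real.exp z.1)) z.2)
  left_inv z := by simp [hn₁]
  right_inv z := by simp [hn₂]
  continuous_toFun := by
    refine continuous_fst.prodMk (continuous_iff_continuousAt.2 fun z₀ => ?_)
    rw [ContinuousAt, tendsto_iff_dist_tendsto_zero]
    have hc : Continuous fun z : ℝ × ℝ =>
        |z.2 - clock μ b (V (Real.exp z.1)) (n z₀.1 z₀.2)| := by
      have := (continuous_clock hb hV).comp
        (by fun_prop : Continuous fun z : ℝ × ℝ => (z.1, n z₀.1 z₀.2))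
      exact (continuous_snd.sub this).abs
    refine squeeze_zero (fun _ => dist_nonneg) (fun z => ?_) (hc.tendsto' z₀ 0 (by simp [hn₁]))
    have := (hV (Real.exp z.1)).abs_sub_le_abs_clock_sub hb (n z.1 z.2) (n z₀.1 z₀.2)
    rwa [hn₁] at this
  continuous_invFun := continuous_fst.prodMk (continuous_clock hb hV)

end Circle

section CircleLimit

variable {μ γm : ℝ} {p : State} {V : ℝ → ℝ → ℝ × ℝ × ℝ}

theorem injective_planeMap (hγ : 0 < γm) (hb : 0 < fluidExp γm) (hp : p ∈ circleLR)
    (hV : ∀ C, IsProfile μ (fluidExp γm) (p 1, p 0, C) (V C)) :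
    Function.Injective (planeMap μ (fluidExp γm) V) := by
  set b := fluidExp γm
  choose n hn₁ hn₂ hnd hnl using fun c => (hV (Real.exp c)).exists_clock_inverse hb.le
  have h0 : ∀ C, rateSq μ b 0 (p 1, p 0, C) = 1 := rateSq_zero_circle hb hp
  have hsol : ∀ c, IsSolutionOn μ γm (stateSpace μ) Set.univ
      (fun t => planeMap μ b V (c, n c t)) := fun c t _ =>
    ⟨(hV _).profileState_mem_stateSpace hb.le (Real.exp_pos c).le (h0 _) (Real.exp_pos _),
      (hV _).hasDerivAt_profileState hb.le (Real.exp_pos c).le (h0 _) (hnd c t)⟩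
  have hinv : ∀ c s, Tendsto (fun τ => OmegaM (planeMap μ b V (c, n c (τ + s))) *
      (planeMap μ b V (c, n c (τ + s)) 3 / (1 - planeMap μ b V (c, n c (τ + s)) 3)) ^
        (-(2 * b))) atBot (𝓝 (Real.exp c)) := fun c s => by
    have h1 : Tendsto (fun τ => Real.exp (n c (τ + s))) atBot (𝓝[>] 0) :=
      Real.tendsto_exp_atBot_nhdsGT.comp
        ((hnl c).comp (tendsto_atBot_add_const_right _ s tendsto_id))
    exact ((hV (Real.exp c)).tendsto_invariant hb.le (Real.exp_pos c).le (h0 _)).comp h1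
  rintro ⟨c, N⟩ ⟨c', N'⟩ h
  have h1 : planeMap μ b V (c, n c (clock μ b (V (Real.exp c)) N)) =
      planeMap μ b V (c', n c' (clock μ b (V (Real.exp c')) N')) := by rw [hn₂, hn₂, h]
  have hflow := (hsol c).eq_of_eq (hsol c') h1
  have hcc : c = c' := by
    refine Real.exp_injective (tendsto_nhds_unique (hinv c (clock μ b (V (Real.exp c)) N)) ?_)
    refine (hinv c' (clock μ b (V (Real.exp c')) N')).congr fun τ => ?_
    rw [hflow τ]
  subst hcc
  have h2 := (strictMono_T hγ (hsol c)).injective (congrFun h1 3)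
  have h3 := ((hV (Real.exp c)).strictMono_clock hb.le).injective h2
  rw [h3]

/-- The parameters are controlled by the state: `N = log h + log r`, where `h = T / (1 - T)`,
the fluid parameter is determined by `Ω_m = C A ^ (2b) / r ^ 4`, and `r` is bounded in terms of
`h` and `Ω_YM`. -/
theorem planeMap_bounds (hb : 0 < fluidExp γm) (hp : p ∈ circleLR)
    (hV : ∀ C, IsProfile μ (fluidExp γm) (p 1, p 0, C) (V C)) (z : ℝ × ℝ) :
    ∃ l, 0 ≤ l ∧ 4 * l ≤ 2 * μ ^ 2 * ((planeMap μ (fluidExp γm) V z 3 /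
          (1 - planeMap μ (fluidExp γm) V z 3)) ^ 2 / √(OmegaYM (planeMap μ (fluidExp γm) V z))) -
        Real.log (OmegaYM (planeMap μ (fluidExp γm) V z)) ∧
      z.2 = Real.log (planeMap μ (fluidExp γm) V z 3 /
        (1 - planeMap μ (fluidExp γm) V z 3)) + l ∧
      z.1 = Real.log (OmegaM (planeMap μ (fluidExp γm) V z)) + 4 * l -
        2 * fluidExp γm * z.2 := by
  set b := fluidExp γm
  obtain ⟨c, N⟩ := z
  have hv := hV (Real.exp c)
  have h0 : rateSq μ b 0 (p 1, p 0, Real.exp c) = 1 := rateSq_zero_circle hb hp _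
  have hA := Real.exp_pos N
  have hC := Real.exp_pos c
  have hr := sqrt_rate_pos μ b (Real.exp N) (V (Real.exp c) (Real.exp N))
  have hr1 : 1 ≤ √(rate μ b (Real.exp N) (V (Real.exp c) (Real.exp N))) :=
    Real.one_le_sqrt.2 (one_le_rate _ _ _ _)
  have hE := hv.energy_ge hA.le
  have hlog := hv.log_energy_le (by linarith [hp.1]) hA.le
  have hY := omegaYM_toState (μ := μ) (A := Real.exp N) (χ := (V (Real.exp c) (Real.exp N)).1)
    (ϖ := (V (Real.exp c) (Real.exp N)).2.1) hr
  have hM := hv.omegaM_profileState hb.le hC.le h0 hA.le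
  have hT : planeMap μ b V (c, N) 3 = Real.exp N /
    (√(rate μ b (Real.exp N) (V (Real.exp c) (Real.exp N))) + Real.exp N) := rfl
  have hYM : OmegaYM (planeMap μ b V (c, N)) = _ := hY
  have hOM : OmegaM (planeMap μ b V (c, N)) = _ := hM
  rw [hT, hYM, hOM]
  simp only at hE hlog ⊢
  generalize √(rate μ b (Real.exp N) (V (Real.exp c) (Real.exp N))) = r at *
  generalize (V (Real.exp c) (Real.exp N)).2.1 ^ 2 + (V (Real.exp c) (Real.exp N)).1 ^ 4 +
    μ ^ 2 * Real.exp N ^ 2 * (V (Real.exp c) (Real.exp N)).1 ^ 2 = E at *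
  have hE0 : 0 < E := by linarith [hp.1]
  have hh : Real.exp N / (r + Real.exp N) / (1 - Real.exp N / (r + Real.exp N)) =
      Real.exp N / r := by
    have : r + Real.exp N ≠ 0 := by positivity
    rw [one_sub_div this, add_sub_cancel_right]
    field_simp
  have hsq : √(E / r ^ 4) = √E / r ^ 2 := by
    rw [Real.sqrt_div hE0.le, show r ^ 4 = (r ^ 2) ^ 2 by ring, Real.sqrt_sq (by positivity)]
  refine ⟨Real.log r, Real.log_nonneg hr1, ?_, ?_, ?_⟩
  · rw [hh, hsq, Real.log_div hE0.ne' (by positivity), Real.log_pow]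
    have : (Real.exp N / r) ^ 2 / (√E / r ^ 2) = Real.exp N ^ 2 / √E := by
      have := Real.sqrt_pos.2 hE0
      field_simp
    rw [this]
    push_cast
    linarith
  · rw [hh, Real.log_div hA.ne' hr.ne', Real.log_exp]; ring
  · rw [Real.log_div (by positivity) (by positivity), Real.log_mul hC.ne' (by positivity),
      Real.log_rpow hA, Real.log_exp, Real.log_exp, Real.log_pow]
    push_cast
    ring

theorem isEmbedding_planeMap (hγ : 0 < γm) (hb : 0 < fluidExp γm) (hp : p ∈ circleLR)
    (hV : ∀ C, IsProfile μ (fluidExp γm) (p 1, p 0, C) (V C)) :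
    IsEmbedding (planeMap μ (fluidExp γm) V) := by
  refine isEmbedding_of_preimage_subset_compact (continuous_planeMap hb.le hV)
    (injective_planeMap hγ hb hp hV) fun z₀ => ?_
  have hx : planeMap μ (fluidExp γm) V z₀ ∈ mixedStates μ :=
    (hV _).profileState_mem_mixedStates hb.le (Real.exp_pos _) (rateSq_zero_circle hb hp _)
      (by simp only; linarith [hp.1]) (Real.exp_pos _)
  set x₀ := planeMap μ (fluidExp γm) V z₀
  have hT0 : 0 < x₀ 3 := hx.1.2.2.1
  have hT1 : 0 < 1 - x₀ 3 := by linarith [hx.1.2.2.2.1]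
  have hY0 : 0 < OmegaYM x₀ := by have := hx.2.2; simp only [OmegaM] at this; linarith
  have hYc : Continuous OmegaYM := by unfold OmegaYM; fun_prop
  have hc3 : ContinuousAt (fun x : State => x 3) x₀ := (continuous_apply 3).continuousAt
  have hh : ContinuousAt (fun x : State => x 3 / (1 - x 3)) x₀ :=
    hc3.div (continuousAt_const.sub hc3) hT1.ne'
  have c1 : ContinuousAt (fun x : State => Real.log (x 3 / (1 - x 3))) x₀ :=
    hh.log (by positivity)
  have c2 : ContinuousAt (fun x => Real.log (OmegaM x)) x₀ :=
    continuous_omegaM.continuousAt.log hx.2.1.ne'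
  have c3 : ContinuousAt (fun x : State => 2 * μ ^ 2 * ((x 3 / (1 - x 3)) ^ 2 /
      √(OmegaYM x)) - Real.log (OmegaYM x)) x₀ :=
    (continuousAt_const.mul ((hh.pow 2).div hYc.continuousAt.sqrt
      (Real.sqrt_pos.2 hY0).ne')).sub (hYc.continuousAt.log hY0.ne')
  have b1 := c1.eventually (Metric.closedBall_mem_nhds _ one_pos)
  have b2 := c2.eventually (Metric.closedBall_mem_nhds _ one_pos)
  have b3 := c3.eventually (Metric.closedBall_mem_nhds _ one_pos)
  set m1 := |Real.log (x₀ 3 / (1 - x₀ 3))| + 1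
  set m2 := |Real.log (OmegaM x₀)| + 1
  set m3 := |2 * μ ^ 2 * ((x₀ 3 / (1 - x₀ 3)) ^ 2 / √(OmegaYM x₀)) - Real.log (OmegaYM x₀)| + 1
  refine ⟨Metric.closedBall 0 (m2 + m3 + 2 * fluidExp γm * (m1 + m3) + (m1 + m3)),
    isCompact_closedBall _ _, _, (b1.and b2).and b3, ?_⟩
  rintro z ⟨⟨hz1, hz2⟩, hz3⟩
  obtain ⟨l, hl0, hl, e2, e1⟩ := planeMap_bounds hb hp hV z
  simp only [Real.dist_eq] at hz1 hz2 hz3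
  have k1 := abs_sub_abs_le_abs_sub (Real.log (planeMap μ (fluidExp γm) V z 3 /
    (1 - planeMap μ (fluidExp γm) V z 3))) (Real.log (x₀ 3 / (1 - x₀ 3)))
  have k2 := abs_sub_abs_le_abs_sub (Real.log (OmegaM (planeMap μ (fluidExp γm) V z)))
    (Real.log (OmegaM x₀))
  have k3 : 4 * l ≤ m3 := by
    have := (le_abs_self _).trans hz3
    have := le_abs_self (2 * μ ^ 2 * ((x₀ 3 / (1 - x₀ 3)) ^ 2 / √(OmegaYM x₀)) -
      Real.log (OmegaYM x₀))
    simp only [m3]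
    linarith
  have hN : |z.2| ≤ m1 + m3 := by
    rw [e2]
    refine (abs_add_le _ _).trans ?_
    rw [abs_of_nonneg hl0]
    simp only [m1]
    linarith
  have hc : |z.1| ≤ m2 + m3 + 2 * fluidExp γm * (m1 + m3) := by
    rw [e1]
    refine (abs_sub _ _).trans ?_
    rw [abs_mul, abs_of_pos (by positivity : 0 < 2 * fluidExp γm)]
    refine add_le_add ((abs_add_le _ _).trans ?_) (by gcongr)
    rw [abs_of_nonneg (by positivity : 0 ≤ 4 * l)]
    simp only [m2]
    linarith
  rw [mem_closedBall_zero_iff, Prod.norm_def, Real.norm_eq_abs, Real.norm_eq_abs]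
  have hm1 : 0 ≤ m1 := by positivity
  have hm2 : 0 ≤ m2 := by positivity
  have hm3 : 0 ≤ m3 := by positivity
  have hm4 : 0 ≤ 2 * fluidExp γm * (m1 + m3) := by positivity
  exact max_le (by linarith) (by linarith)

theorem isAlphaLimitOfTwoParameterSet_of_mem_circleLR (hγ : 0 < γm) (hb : 0 < fluidExp γm)
    (hp : p ∈ circleLR) : IsAlphaLimitOfTwoParameterSet μ γm p := by
  choose V hV using fun C => exists_isProfile (μ := μ) hb.le (p 1, p 0, C)
  choose n hn₁ hn₂ hnd hnl using fun c => (hV (Real.exp c)).exists_clock_inverse hb.le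
  have h0 : ∀ C, rateSq μ (fluidExp γm) 0 (p 1, p 0, C) = 1 := rateSq_zero_circle hb hp
  refine ⟨fun z => planeMap μ (fluidExp γm) V (z.1, n z.1 z.2),
    (isEmbedding_planeMap hγ hb hp hV).comp
      (clockHomeomorph hb.le hV hn₁ hn₂).isEmbedding, fun c => ⟨fun t _ => ⟨?_, ?_⟩, ?_⟩, ?_⟩
  · exact (hV _).profileState_mem_mixedStates hb.le (Real.exp_pos c) (h0 _)
      (by simp only; linarith [hp.1]) (Real.exp_pos _)
  · exact (hV _).hasDerivAt_profileState hb.le (Real.exp_pos c).le (h0 _) (hnd c t)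
  · have := (hV (Real.exp c)).tendsto_profileState hb.le (h0 _) (hnl c)
    rwa [eq_vec_of_comp_eq_zero hp.2.2 hp.2.1] at this
  · intro a u hu hup
    obtain ⟨C, A, r, χ, ϖ, h, hC⟩ := exists_isPhysical hb.le
      (hu.mono (mixedStates_subset μ) subset_rfl) (pastBound_one_sub_q_of_pos hγ hb hu) hp.2.1 hup
    have hCpos : 0 < C := by
      have ht : a - 1 < a := by linarith
      have h1 := (hu _ ht).1.2.1
      have h2 := h.r_ge _ ht
      have h3 := h.A_pos _ ht
      rw [hC _ ht]
      positivity
    have hv := hV (Real.exp (Real.log C))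
    have hn := hn₂ (Real.log C)
    have hgoal : ∃ s, ∀ t < a, u t =
        profileState μ (fluidExp γm) (V (Real.exp (Real.log C)))
          (Real.exp (n (Real.log C) (t + s))) :=
      h.exists_eq_profileState hb.le hCpos.le (by rw [Real.exp_log hCpos] at hv ⊢; exact hv) hn
    obtain ⟨s, hs⟩ := hgoal
    exact ⟨Real.log C, s, hs⟩

end CircleLimit

end MassiveYM

theorem mainTheorem2 (μ γm : ℝ) (hμ : μ ≠ 0) (hγ : 0 < γm) (hγ2 : γm ≤ 2) :
    (γm < 4 / 3 →
      (∀ (a : ℝ) (u : ℝ → MassiveYM.State),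
        MassiveYM.IsSolutionOn μ γm (MassiveYM.mixedStates μ) (Set.Iio a) u →
          ∃ p ∈ MassiveYM.circleLR, Tendsto u atBot (𝓝 p)) ∧
      ∀ p ∈ MassiveYM.circleLR, MassiveYM.IsAlphaLimitOfTwoParameterSet μ γm p) ∧
    (γm = 4 / 3 →
      (∀ (a : ℝ) (u : ℝ → MassiveYM.State),
        MassiveYM.IsSolutionOn μ γm (MassiveYM.mixedStates μ) (Set.Iio a) u →
          ∃ p ∈ MassiveYM.diskDR, Tendsto u atBot (𝓝 p)) ∧
      (∀ p ∈ MassiveYM.diskDR,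
        MassiveYM.IsAlphaLimitOfUniqueSolution μ γm (MassiveYM.stateSpace μ) p) ∧
      ∀ p ∈ MassiveYM.diskDR,
        (0 < MassiveYM.OmegaM p ∧ MassiveYM.OmegaM p < 1) ↔
          MassiveYM.IsAlphaLimitOfUniqueSolution μ γm (MassiveYM.mixedStates μ) p) ∧
    (4 / 3 < γm →
      ∀ (a : ℝ) (u : ℝ → MassiveYM.State),
        MassiveYM.IsSolutionOn μ γm (MassiveYM.mixedStates μ) (Set.Iio a) u →
          Tendsto u atBot (𝓝 MassiveYM.pointFL0)) := by
  refine ⟨fun h => ?_, fun h => ?_, fun h a u hu => ?_⟩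
  · have hb : 0 < MassiveYM.fluidExp γm := by unfold MassiveYM.fluidExp; linarith
    exact ⟨fun a u hu => MassiveYM.exists_tendsto_circleLR hγ hb hu, fun p hp =>
      MassiveYM.isAlphaLimitOfTwoParameterSet_of_mem_circleLR hγ hb hp⟩
  · subst h
    have hb := MassiveYM.fluidExp_four_thirds
    refine ⟨fun a u hu => ?_, fun p hp => MassiveYM.isAlphaLimitOfUniqueSolution_stateSpace hp,
      fun p hp => MassiveYM.isAlphaLimitOfUniqueSolution_mixedStates_iff hp⟩
    have hus := hu.mono (MassiveYM.mixedStates_subset μ) subset_rfl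
    exact MassiveYM.exists_tendsto_of_pastBound hγ hb.ge hus
      (MassiveYM.pastBound_one_sub_q_of_eq_zero hγ hb hus)
  · exact MassiveYM.tendsto_pointFL0 hγ (by unfold MassiveYM.fluidExp; linarith) hu
end
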